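/- Let $M$ be a smooth manifold with a smooth pseudo-Riemannian metric $g$ and Levi-Civita connection $\nabla$, and let $V$ be a smooth rank-3 subbundle of $\operatorname{End}(TM)$ such that near each point of $M$ the bundle $V$ has a smooth frame $(I,J,K)$ of $g$-skew-symmetric endomorphisms satisfying $$I^2=-J^2=-K^2=-\mathrm{Id},\qquad IJ=-JI=K,\qquad JK=-KJ=-I,\qquad KI=-IK=J$$ (that is, $(M,g,V)$ is an almost para-quaternion-Hermitian manifold; necessarily $\dim M=4m$ and $g$ has signature $(2m,2m)$). For a skew-symmetric endomorphism $A$ put $\Omega_A(X,Y)=g(X,AY)$. The 4-form $$\Omega=\Omega_I\wedge\Omega_I-\Omega_J\wedge\Omega_J-\Omega_K\wedge\Omega_K$$ does not depend on the choice of $(I,J,K)$, hence is globally defined on $M$. Theorem 1. Suppose that $(M,g,V)$ is nearly para-quaternion Kähler, i.e. $(\nabla_X\Omega)(X,Y,Z,W)=0$ for all (local smooth) vector fields $X,Y,Z,W$ on $M$. Then $(M,g,V)$ is para-quaternion Kähler: $V$ is invariant under covariant differentiation with respect to $\nabla$, i.e. $\nabla_U A$ is a section of $V$ for every local smooth section $A$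 of $V$ and every local smooth vector field $U$. -/

import Mathlib

open Bundle (TotalSpace Trivialization)
open scoped Manifold Topology
open scoped ContDiff

noncomputable section

namespace ParaQuaternion

theorem mvfderiv_congr {E : Type*} [NormedAddCommGroup E] [NormedSpace ℝ E]
    {F : Type*} [NormedAddCommGroup F] [NormedSpace ℝ F] {M : Type*} [TopologicalSpace M] [ChartedSpace E M]
    {f f' : M → F} {x : M}
    (h : f =ᶠ[𝓝 x] f') : mvfderiv 𝓘(ℝ, E) f x = mvfderiv 𝓘(ℝ, E) f' x := by
  simp only [mvfderiv, h.mfderiv_eq]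
  rfl

theorem mvfderiv_eq_fderiv {E : Type*} [NormedAddCommGroup E] [NormedSpace ℝ E]
    {M : Type*} [TopologicalSpace M] [ChartedSpace E M]
    {F : Type*} [NormedAddCommGroup F] [NormedSpace ℝ F] {f : M → F} {x : M}
   (hf : MDifferentiableAt 𝓘(ℝ, E) 𝓘(ℝ, F) f x) (v : E) :
   mvfderiv 𝓘(ℝ, E) f x v = fderiv ℝ (f ∘ (extChartAt 𝓘(ℝ, E) x).symm) (extChartAt 𝓘(ℝ, E) x x) v := by
  simp only [mvfderiv, mfderiv, hf, modelWithCornersSelf_coe, Set.range_id, fderivWithin_univ]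
  rfl

theorem differentiableAt_comp_chart {E : Type*} [NormedAddCommGroup E] [NormedSpace ℝ E]
    {M : Type*} [TopologicalSpace M] [ChartedSpace E M]
    {F : Type*} [NormedAddCommGroup F] [NormedSpace ℝ F] {f : M → F} {x : M}
   (hf : MDifferentiableAt 𝓘(ℝ, E) 𝓘(ℝ, F) f x)  :
   DifferentiableAt ℝ (f ∘ (extChartAt 𝓘(ℝ, E) x).symm) (extChartAt 𝓘(ℝ, E) x x) := by
  have := hf.differentiableWithinAt_writtenInExtChartAt
  simp only [writtenInExtChartAt, modelWithCornersSelf_coe, Set.range_id, differentiableWithinAt_univ] at this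
  exact this

section Metric

variable (E : Type*) [NormedAddCommGroup E] [NormedSpace ℝ E]
  (M : Type*) [TopologicalSpace M] [ChartedSpace E M] [IsManifold 𝓘(ℝ, E) ∞ M]

/-- A smooth pseudo-Riemannian metric on `M`: a smooth symmetric nondegenerate `(0,2)`-tensor
field, of arbitrary signature. -/
structure PseudoRiemannianMetric where
  /-- The scalar product on each tangent space. -/
  inner (x : M) : TangentSpace 𝓘(ℝ, E) x →L[ℝ] TangentSpace 𝓘(ℝ, E) x →L[ℝ] ℝ
  symm (x : M) (v w : TangentSpace 𝓘(ℝ, E) x) : inner x v w = inner x w v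
  nondegenerate (x : M) (v : TangentSpace 𝓘(ℝ, E) x) (hv : ∀ w, inner x v w = 0) : v = 0
  contMDiff : ContMDiff 𝓘(ℝ, E) (𝓘(ℝ, E).prod 𝓘(ℝ, E →L[ℝ] E →L[ℝ] ℝ)) ∞
    (fun x ↦ TotalSpace.mk' (E →L[ℝ] E →L[ℝ] ℝ)
      (E := fun x ↦ TangentSpace 𝓘(ℝ, E) x →L[ℝ] TangentSpace 𝓘(ℝ, E) x →L[ℝ] ℝ) x (inner x))

end Metric

variable {E : Type*} [NormedAddCommGroup E] [NormedSpace ℝ E]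
  {M : Type*} [TopologicalSpace M] [ChartedSpace E M] [IsManifold 𝓘(ℝ, E) ∞ M]

/-- The components of a vector field `σ` near `x` in the coordinates of the chart at `x`. -/
def fieldRep (σ : ∀ y : M, TangentSpace 𝓘(ℝ, E) y) (x y : M) : E :=
  (trivializationAt E (TangentSpace 𝓘(ℝ, E) : M → Type _) x ⟨y, σ y⟩).2

/-- The components `g_{ij}` of the metric near `x` in the coordinates of the chart at `x`. -/
def PseudoRiemannianMetric.rep (g : PseudoRiemannianMetric E M) (x y : M) : E →L[ℝ] E →L[ℝ] ℝ :=
  (trivializationAt (E →L[ℝ] E →L[ℝ] ℝ)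
    (fun y : M ↦ TangentSpace 𝓘(ℝ, E) y →L[ℝ] TangentSpace 𝓘(ℝ, E) y →L[ℝ] ℝ) x
      ⟨y, g.inner y⟩).2

/-- The differential at `x` of the coordinates of the chart at `x`. -/
def toCoord (x : M) : TangentSpace 𝓘(ℝ, E) x →L[ℝ] E :=
  (trivializationAt E (TangentSpace 𝓘(ℝ, E) : M → Type _) x).continuousLinearMapAt ℝ x

/-- The inverse of `toCoord x`: the vector at `x` with given coordinates. -/
def ofCoord (x : M) : E →L[ℝ] TangentSpace 𝓘(ℝ, E) x :=
  (trivializationAt E (TangentSpace 𝓘(ℝ, E) : M → Type _) x).symmL ℝ x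

/-- The partial derivatives `u ↦ ∂_u g_{ij}` at `x` in the coordinates of the chart at `x`. -/
def PseudoRiemannianMetric.derivRep (g : PseudoRiemannianMetric E M) (x : M) :
    E →L[ℝ] E →L[ℝ] E →L[ℝ] ℝ :=
  (mvfderiv 𝓘(ℝ, E) (g.rep x) x) ∘L ofCoord x

/-- For `D u w z = ∂_u g(w, z)`, the Koszul form
`(u, z) ↦ (∂_u g(w, z) + ∂_w g(u, z) - ∂_z g(w, u)) / 2`. -/
def koszul (D : E →L[ℝ] E →L[ℝ] E →L[ℝ] ℝ) (w : E) : E →L[ℝ] E →L[ℝ] ℝ :=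
  (1 / 2 : ℝ) • (D.flip w + D w - (D.flip w).flip)

/-- The Christoffel symbols of `g` at `x`, in the coordinates of the chart at `x`:
`2 g(Γ(w, u), z) = ∂_u g(w, z) + ∂_w g(u, z) - ∂_z g(w, u)`. -/
def PseudoRiemannianMetric.christoffel (g : PseudoRiemannianMetric E M) (x : M) (w : E) :
    E →L[ℝ] E :=
  (g.rep x x).inverse ∘L koszul (g.derivRep x) w

/-- The map `v ↦ ∇_v σ` at `x`: in the coordinates of the chart at `x`,
`(∇_v σ)^k = ∂_v σ^k + Γ^k_{ij} v^i σ^j`. -/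
def PseudoRiemannianMetric.leviCivitaFun (g : PseudoRiemannianMetric E M)
    (σ : ∀ y : M, TangentSpace 𝓘(ℝ, E) y) (x : M) :
    TangentSpace 𝓘(ℝ, E) x →L[ℝ] TangentSpace 𝓘(ℝ, E) x :=
  ofCoord x ∘L (mvfderiv 𝓘(ℝ, E) (fieldRep σ x) x +
    g.christoffel x (fieldRep σ x x) ∘L toCoord x)

theorem fieldRep_add (σ τ : ∀ y : M, TangentSpace 𝓘(ℝ, E) y) (x : M) :
    fieldRep (σ + τ) x =ᶠ[𝓝 x] fieldRep σ x + fieldRep τ x := by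
  filter_upwards [(trivializationAt E (TangentSpace 𝓘(ℝ, E) : M → Type _) x).open_baseSet.mem_nhds
    (FiberBundle.mem_baseSet_trivializationAt' x)] with y hy
  exact ((trivializationAt E (TangentSpace 𝓘(ℝ, E) : M → Type _) x).linear ℝ hy).map_add _ _

theorem fieldRep_smul (f : M → ℝ) (σ : ∀ y : M, TangentSpace 𝓘(ℝ, E) y) (x : M) :
    fieldRep (f • σ) x =ᶠ[𝓝 x] f • fieldRep σ x := by
  filter_upwards [(trivializationAt E (TangentSpace 𝓘(ℝ, E) : M → Type _) x).open_baseSet.mem_nhds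
    (FiberBundle.mem_baseSet_trivializationAt' x)] with y hy
  exact ((trivializationAt E (TangentSpace 𝓘(ℝ, E) : M → Type _) x).linear ℝ hy).map_smul _ _

theorem ofCoord_toCoord (x : M) (v : TangentSpace 𝓘(ℝ, E) x) : ofCoord x (toCoord x v) = v :=
  (trivializationAt E (TangentSpace 𝓘(ℝ, E) : M → Type _) x).symmL_continuousLinearMapAt
    (FiberBundle.mem_baseSet_trivializationAt' x) v

theorem toCoord_ofCoord (x : M) (v : E) : toCoord x (ofCoord x v) = v :=
  (trivializationAt E (TangentSpace 𝓘(ℝ, E) : M → Type _) x).continuousLinearMapAt_symmL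
    (FiberBundle.mem_baseSet_trivializationAt' x) v

theorem fieldRep_self (σ : ∀ y : M, TangentSpace 𝓘(ℝ, E) y) (x : M) :
    fieldRep σ x x = toCoord x (σ x) := by
  simp [fieldRep, toCoord, Trivialization.continuousLinearMapAt_apply,
    Trivialization.linearMapAt_apply]

theorem mdifferentiableAt_fieldRep {σ : ∀ y : M, TangentSpace 𝓘(ℝ, E) y} {x : M} :
    MDiffAt (T% σ) x ↔ MDifferentiableAt 𝓘(ℝ, E) 𝓘(ℝ, E) (fieldRep σ x) x :=
  mdifferentiableAt_section (F := E) 𝓘(ℝ, E) σ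

theorem koszul_apply (D : E →L[ℝ] E →L[ℝ] E →L[ℝ] ℝ) (u w z : E) :
    koszul D w u z = (D u w z + D w u z - D z w u) / 2 := by
  rw [div_eq_inv_mul, ← one_div]
  rfl

theorem koszul_add (D : E →L[ℝ] E →L[ℝ] E →L[ℝ] ℝ) (v w : E) :
    koszul D (v + w) = koszul D v + koszul D w := by
  ext u z
  rw [add_apply, add_apply]
  simp only [koszul_apply]
  simp
  ring

theorem koszul_smul (D : E →L[ℝ] E →L[ℝ] E →L[ℝ] ℝ) (c : ℝ) (w : E) :
    koszul D (c • w) = c • koszul D w := by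
  ext u z
  rw [smul_apply, smul_apply]
  simp only [koszul_apply]
  simp
  ring

theorem christoffel_add (g : PseudoRiemannianMetric E M) (x : M) (v w : E) :
    g.christoffel x (v + w) = g.christoffel x v + g.christoffel x w := by
  rw [PseudoRiemannianMetric.christoffel, koszul_add, ContinuousLinearMap.comp_add]
  rfl

theorem christoffel_smul (g : PseudoRiemannianMetric E M) (x : M) (c : ℝ) (w : E) :
    g.christoffel x (c • w) = c • g.christoffel x w := by
  rw [PseudoRiemannianMetric.christoffel, koszul_smul, ContinuousLinearMap.comp_smul]
  rfl

theorem isCovariantDerivativeOn_leviCivitaFun (g : PseudoRiemannianMetric E M) :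
    IsCovariantDerivativeOn E g.leviCivitaFun Set.univ where
  add {σ τ x} hσ hτ _ := by
    rw [mdifferentiableAt_fieldRep] at hσ hτ
    ext v
    simp [PseudoRiemannianMetric.leviCivitaFun, mvfderiv_congr (fieldRep_add σ τ x),
      (fieldRep_add σ τ x).eq_of_nhds, mvfderiv_add hσ hτ, christoffel_add]
    abel
  leibniz {σ f x} hσ hf _ := by
    rw [mdifferentiableAt_fieldRep] at hσ
    ext v
    simp [PseudoRiemannianMetric.leviCivitaFun, mvfderiv_congr (fieldRep_smul f σ x),
      (fieldRep_smul f σ x).eq_of_nhds, mvfderiv_smul hf hσ, christoffel_smul]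
    rw [fieldRep_self, ofCoord_toCoord]
    abel

/-- The Levi-Civita connection of `g`, see also `leviCivita_metric` and `leviCivita_torsion`. -/
def PseudoRiemannianMetric.leviCivita (g : PseudoRiemannianMetric E M) :
    CovariantDerivative 𝓘(ℝ, E) E (TangentSpace 𝓘(ℝ, E) : M → Type _) :=
  ⟨g.leviCivitaFun, isCovariantDerivativeOn_leviCivitaFun g⟩

theorem rep_apply (g : PseudoRiemannianMetric E M) {x y : M}
    (hy : y ∈ (trivializationAt E (TangentSpace 𝓘(ℝ, E) : M → Type _) x).baseSet) (u w : E) :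
    g.rep x y u w = g.inner y
      ((trivializationAt E (TangentSpace 𝓘(ℝ, E) : M → Type _) x).symm y u)
      ((trivializationAt E (TangentSpace 𝓘(ℝ, E) : M → Type _) x).symm y w) := by
  have := inCoordinates_apply_eq₂ (𝕜 := ℝ) (F₁ := E) (F₂ := E) (F₃ := ℝ)
    (E₁ := (TangentSpace 𝓘(ℝ, E) : M → Type _)) (E₂ := (TangentSpace 𝓘(ℝ, E) : M → Type _))
    (E₃ := Bundle.Trivial M ℝ) (ϕ := g.inner y) (v := u) (w := w) hy hy (Set.mem_univ _)
  refine Eq.trans ?_ (this.trans ?_)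
  · rfl
  · simp

theorem rep_fieldRep (g : PseudoRiemannianMetric E M) (x : M)
    (σ τ : ∀ y : M, TangentSpace 𝓘(ℝ, E) y) :
    (fun y ↦ g.inner y (σ y) (τ y)) =ᶠ[𝓝 x] fun y ↦ g.rep x y (fieldRep σ x y) (fieldRep τ x y) := by
  filter_upwards [(trivializationAt E (TangentSpace 𝓘(ℝ, E) : M → Type _) x).open_baseSet.mem_nhds
    (FiberBundle.mem_baseSet_trivializationAt' x)] with y hy
  rw [rep_apply g hy, fieldRep, fieldRep,
   Trivialization.symm_apply_apply_mk _ hy, Trivialization.symm_apply_apply_mk _ hy]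

theorem rep_self (g : PseudoRiemannianMetric E M) (x : M) (u w : E) :
    g.rep x x u w = g.inner x (ofCoord x u) (ofCoord x w) := by
  have h := FiberBundle.mem_baseSet_trivializationAt' (F := E)
    (E := (TangentSpace 𝓘(ℝ, E) : M → Type _)) x
  rw [rep_apply g h, ofCoord, Trivialization.symmL_apply _ h, Trivialization.symmL_apply _ h]

theorem rep_invertible [FiniteDimensional ℝ E] (g : PseudoRiemannianMetric E M) (x : M) :
    (g.rep x x).IsInvertible := by
  have hinj : Function.Injective (g.rep x x) := by
    rw [injective_iff_map_eq_zero]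
    intro u hu
    have : ofCoord x u = 0 := by
      apply g.nondegenerate
      intro w
      have := rep_self g x u (toCoord x w)
      rw [ofCoord_toCoord, hu] at this
      simpa using this.symm
    rw [← toCoord_ofCoord x u, this, map_zero]
  have hf : Module.finrank ℝ E = Module.finrank ℝ (E →L[ℝ] ℝ) := by
    rw [← (LinearMap.toContinuousLinearMap (𝕜 := ℝ) (E := E) (F' := ℝ)).finrank_eq]
    exact (Subspace.dual_finrank_eq (K := ℝ) (V := E)).symm
  exact ⟨(LinearEquiv.ofInjectiveOfFinrankEq (g.rep x x).toLinearMap hinj hf).toContinuousLinearEquiv,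
    by ext; rfl⟩

theorem rep_christoffel [FiniteDimensional ℝ E] (g : PseudoRiemannianMetric E M) (x : M)
    (w u z : E) : g.rep x x (g.christoffel x w u) z = koszul (g.derivRep x) w u z := by
  obtain ⟨e, he⟩ := rep_invertible g x
  rw [PseudoRiemannianMetric.christoffel, ← he]
  simp

theorem mdifferentiableAt_rep (g : PseudoRiemannianMetric E M) (x : M) :
   MDifferentiableAt 𝓘(ℝ, E) 𝓘(ℝ, E →L[ℝ] E →L[ℝ] ℝ) (g.rep x) x := by
  have h := (g.contMDiff x).mdifferentiableAt (by simp)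
  exact (mdifferentiableAt_section (F := E →L[ℝ] E →L[ℝ] ℝ) (E := fun x ↦ TangentSpace 𝓘(ℝ, E) x →L[ℝ] TangentSpace 𝓘(ℝ, E) x →L[ℝ] ℝ) 𝓘(ℝ, E) g.inner).1 h

theorem toCoord_eq (x : M) (v : E) : toCoord x v = v := by
  have : toCoord (E := E) x = mfderiv 𝓘(ℝ, E) 𝓘(ℝ, E) (extChartAt 𝓘(ℝ, E) x) x :=
    TangentBundle.continuousLinearMapAt_trivializationAt (by simp)
  rw [this, mfderiv_extChartAt_self]; rfl

theorem ofCoord_eq (x : M) (v : E) : ofCoord x v = v := by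
  have := ofCoord_toCoord (E := E) x v
  rwa [toCoord_eq x v] at this

theorem derivRep_symm (g : PseudoRiemannianMetric E M) (x : M) (u a b : E) :
    g.derivRep x u a b = g.derivRep x u b a := by
  have hg := mdifferentiableAt_rep g x
  have hs : (fun y => g.rep x y a b) =ᶠ[𝓝 x] fun y => g.rep x y b a := by
    filter_upwards [(trivializationAt E (TangentSpace 𝓘(ℝ, E) : M → Type _) x).open_baseSet.mem_nhds
      (FiberBundle.mem_baseSet_trivializationAt' x)] with y hy
    rw [rep_apply g hy, rep_apply g hy, g.symm]
  have ev : ∀ a b : E, g.derivRep x u a b = mvfderiv 𝓘(ℝ, E) (fun y => g.rep x y a b) x (ofCoord x u) := by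
    intro a b
    have h1 : MDifferentiableAt 𝓘(ℝ, E) 𝓘(ℝ, E →L[ℝ] ℝ) (fun y ↦ g.rep x y a) x := hg.clm_apply mdifferentiableAt_const
    have h2 : MDifferentiableAt 𝓘(ℝ, E) 𝓘(ℝ, ℝ) (fun y ↦ g.rep x y a b) x := h1.clm_apply mdifferentiableAt_const
    refine Eq.trans ?_ (mvfderiv_eq_fderiv h2 _).symm
    have a' := (differentiableAt_comp_chart hg).hasFDerivAt
    have := ((a'.clm_apply (hasFDerivAt_const a _)).clm_apply (hasFDerivAt_const b _)).fderiv
    refine Eq.trans ?_ (congrArg (fun L : E →L[ℝ] ℝ => L (ofCoord x u)) this).symm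
    have := mvfderiv_eq_fderiv hg (ofCoord x u)
    simp [PseudoRiemannianMetric.derivRep]
    exact congrArg (fun L : E →L[ℝ] E →L[ℝ] ℝ => L a b) this
  rw [ev, ev, mvfderiv_congr hs]

/-- The Levi-Civita connection is compatible with the metric. -/
theorem leviCivita_metric [FiniteDimensional ℝ E] (g : PseudoRiemannianMetric E M) {x : M}
    {σ τ : ∀ y : M, TangentSpace 𝓘(ℝ, E) y} (hσ : MDiffAt (T% σ) x) (hτ : MDiffAt (T% τ) x)
    (v : TangentSpace 𝓘(ℝ, E) x) :
    mvfderiv 𝓘(ℝ, E) (fun y ↦ g.inner y (σ y) (τ y)) x v =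
      g.inner x (g.leviCivita σ x v) (τ x) + g.inner x (σ x) (g.leviCivita τ x v) := by
  rw [mdifferentiableAt_fieldRep] at hσ hτ
  have hg := mdifferentiableAt_rep g x
  have h1 : MDifferentiableAt 𝓘(ℝ, E) 𝓘(ℝ, E →L[ℝ] ℝ) (fun y ↦ g.rep x y (fieldRep σ x y)) x := hg.clm_apply hσ
  have h2 : MDifferentiableAt 𝓘(ℝ, E) 𝓘(ℝ, ℝ) (fun y ↦ g.rep x y (fieldRep σ x y) (fieldRep τ x y)) x := h1.clm_apply hτ
  rw [mvfderiv_congr (rep_fieldRep g x σ τ)]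
  have key : mvfderiv 𝓘(ℝ, E) (fun y ↦ g.rep x y (fieldRep σ x y) (fieldRep τ x y)) x v =
     (mvfderiv 𝓘(ℝ, E) (g.rep x) x v) (fieldRep σ x x) (fieldRep τ x x) +
     g.rep x x (mvfderiv 𝓘(ℝ, E) (fieldRep σ x) x v) (fieldRep τ x x) +
     g.rep x x (fieldRep σ x x) (mvfderiv 𝓘(ℝ, E) (fieldRep τ x) x v) := by
    refine (mvfderiv_eq_fderiv h2 v).trans ?_
    rw [show mvfderiv 𝓘(ℝ, E) (g.rep x) x v = _ from mvfderiv_eq_fderiv hg v,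
      show mvfderiv 𝓘(ℝ, E) (fieldRep σ x) x v = _ from mvfderiv_eq_fderiv hσ v,
      show mvfderiv 𝓘(ℝ, E) (fieldRep τ x) x v = _ from mvfderiv_eq_fderiv hτ v]
    have a := (differentiableAt_comp_chart hg).hasFDerivAt
    have b := (differentiableAt_comp_chart hσ).hasFDerivAt
    have c := (differentiableAt_comp_chart hτ).hasFDerivAt
    have := ((a.clm_apply b).clm_apply c).fderiv
    refine (congrArg (fun L : E →L[ℝ] ℝ => L v) this).trans ?_
    simp only [Function.comp_apply, extChartAt_to_inv]
    refine (add_comm _ _).trans ?_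
    refine congrArg₂ (· + ·) ?_ rfl
    refine (add_comm _ _).trans ?_
    rfl
  rw [key]
  have dv : mvfderiv 𝓘(ℝ, E) (g.rep x) x v = g.derivRep x (toCoord x v) := by
    simp [PseudoRiemannianMetric.derivRep, ofCoord_toCoord]
  have e : ∀ a b, g.inner x a b = g.rep x x (toCoord x a) (toCoord x b) := by
    intro a b; rw [rep_self, ofCoord_toCoord, ofCoord_toCoord]
  have sy : ∀ a b, g.rep x x a b = g.rep x x b a := by
    intro a b; rw [rep_self, rep_self, g.symm]
  have sd := derivRep_symm g x
  change _ = g.inner x (g.leviCivitaFun σ x v) (τ x) + g.inner x (σ x) (g.leviCivitaFun τ x v)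
  simp only [e, PseudoRiemannianMetric.leviCivitaFun, ContinuousLinearMap.comp_apply, toCoord_ofCoord, add_apply, map_add, ← fieldRep_self]
  rw [rep_christoffel, sy (fieldRep σ x x) (g.christoffel x _ _), rep_christoffel, koszul_apply, koszul_apply, dv, fieldRep_self, fieldRep_self]
  simp only [sd (toCoord x v) (toCoord x (τ x)), sd (toCoord x (σ x)) (toCoord x (τ x)),sd (toCoord x (τ x)) (toCoord x (σ x))]
  ring

theorem christoffel_symm [FiniteDimensional ℝ E] (g : PseudoRiemannianMetric E M) (x : M) (u w : E) :
    g.christoffel x u w = g.christoffel x w u := by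
  obtain ⟨e, he⟩ := rep_invertible g x
  apply e.injective
  have : ∀ v, e v = g.rep x x v := fun v => by rw [← he]; rfl
  ext z
  rw [this, this, rep_christoffel, rep_christoffel, koszul_apply, koszul_apply, derivRep_symm g x z w u]
  ring

theorem mpullbackWithin_eq_fieldRep (x : M) (σ : ∀ y : M, TangentSpace 𝓘(ℝ, E) y) :
    VectorField.mpullbackWithin 𝓘(ℝ, E) 𝓘(ℝ, E) (extChartAt 𝓘(ℝ, E) x).symm σ (Set.range 𝓘(ℝ, E))
     =ᶠ[𝓝 (extChartAt 𝓘(ℝ, E) x x)] fieldRep σ x ∘ (extChartAt 𝓘(ℝ, E) x).symm := by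
  filter_upwards [extChartAt_target_mem_nhds (I := 𝓘(ℝ, E)) x] with y hy
  have hp : (extChartAt 𝓘(ℝ, E) x).symm y ∈ (chartAt E x).source := by
    rw [← extChartAt_source 𝓘(ℝ, E)]; exact (extChartAt 𝓘(ℝ, E) x).map_target hy
  have := TangentBundle.symmL_trivializationAt (𝕜 := ℝ) (I := 𝓘(ℝ, E)) hp
  rw [(extChartAt 𝓘(ℝ, E) x).right_inv hy] at this
  have hb : (extChartAt 𝓘(ℝ, E) x).symm y ∈ (trivializationAt E (TangentSpace 𝓘(ℝ, E) : M → Type _) x).baseSet := by simpa using hp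
  rw [VectorField.mpullbackWithin_apply]
  have h2 : (mfderivWithin 𝓘(ℝ, E) 𝓘(ℝ, E) (extChartAt 𝓘(ℝ, E) x).symm (Set.range 𝓘(ℝ, E)) y) =
    (((trivializationAt E (TangentSpace 𝓘(ℝ, E) : M → Type _) x).continuousLinearEquivAt ℝ _ hb).symm : E →L[ℝ] _) := by
    refine this.symm.trans ?_
    refine ContinuousLinearMap.ext fun v ↦ ?_
    exact Trivialization.symmL_apply _ hb v
  refine (congrArg (fun L : E →L[ℝ] TangentSpace 𝓘(ℝ, E) ((extChartAt 𝓘(ℝ, E) x).symm y) ↦ L.inverse (σ ((extChartAt 𝓘(ℝ, E) x).symm y))) h2).trans ?_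
  simp only [ContinuousLinearMap.inverse_equiv]
  rfl

/-- The Levi-Civita connection is torsion-free. -/
theorem leviCivita_torsion [FiniteDimensional ℝ E] (g : PseudoRiemannianMetric E M) :
    g.leviCivita.torsion = 0 := by
  have : IsManifold 𝓘(ℝ, E) 2 M := inferInstance
  rw [CovariantDerivative.torsion_eq_zero_iff]
  intro σ τ x hσ hτ
  rw [mdifferentiableAt_fieldRep] at hσ hτ
  change g.leviCivitaFun τ x (σ x) - g.leviCivitaFun σ x (τ x) = _
  simp only [PseudoRiemannianMetric.leviCivitaFun, ContinuousLinearMap.comp_apply, add_apply, map_add, ← fieldRep_self]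
  rw [christoffel_symm g x _ _, add_sub_add_right_eq_sub]
  rw [VectorField.mlieBracket, VectorField.mlieBracketWithin_apply, mfderiv_extChartAt_self]
  have hid := fun v : E ↦ congrArg (fun L : E →L[ℝ] E ↦ L v) (ContinuousLinearMap.inverse_id (R := ℝ) (M := E))
  refine Eq.trans ?_ (hid _).symm
  simp only [modelWithCornersSelf_coe, Set.range_id, Set.preimage_univ, Set.univ_inter]
  have a := mpullbackWithin_eq_fieldRep x σ
  have b := mpullbackWithin_eq_fieldRep x τ
  simp only [modelWithCornersSelf_coe, Set.range_id] at a b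
  have gen : ∀ (V W V' W' : E → E) (y : E), V =ᶠ[𝓝 y] V' → W =ᶠ[𝓝 y] W' →
      VectorField.lieBracketWithin ℝ V W Set.univ y =
        fderiv ℝ W' y (V' y) - fderiv ℝ V' y (W' y) := by
    intro V W V' W' y h h'
    rw [VectorField.lieBracketWithin_univ, h.lieBracket_vectorField_eq h', VectorField.lieBracket]
  refine Eq.trans ?_ (gen _ _ _ _ _ a b).symm
  have h0 := mvfderiv_eq_fderiv hσ (τ x)
  have h0' := mvfderiv_eq_fderiv hτ (σ x)
  rw [← map_sub]
  refine (ofCoord_eq x _).trans ?_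
  have r : ∀ ρ : ∀ y : M, TangentSpace 𝓘(ℝ, E) y, (fieldRep ρ x ∘ (extChartAt 𝓘(ℝ, E) x).symm) (extChartAt 𝓘(ℝ, E) x x) = ρ x := by
    intro ρ
    simp only [Function.comp_apply, extChartAt_to_inv, fieldRep_self]; exact toCoord_eq x _
  rw [r, r]
  exact congrArg₂ (· - ·) h0' h0

/-- The relations `I² = -J² = -K² = -Id`, `IJ = -JI = K`, `JK = -KJ = -I`, `KI = -IK = J`. -/
structure IsParaQuaternionTriple {T : Type*} [AddCommGroup T] [Module ℝ T] [TopologicalSpace T]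
    [IsTopologicalAddGroup T] (I J K : T →L[ℝ] T) : Prop where
  I_I : I ∘L I = -ContinuousLinearMap.id ℝ T
  J_J : J ∘L J = ContinuousLinearMap.id ℝ T
  K_K : K ∘L K = ContinuousLinearMap.id ℝ T
  I_J : I ∘L J = K
  J_I : J ∘L I = -K
  J_K : J ∘L K = -I
  K_J : K ∘L J = I
  K_I : K ∘L I = J
  I_K : I ∘L K = -J

/-- `(I, J, K)` is a basis of the fibre `V x` consisting of `g`-skew endomorphisms of `T_x M` that
satisfy the para-quaternion relations. -/
structure IsAdaptedBasis (g : PseudoRiemannianMetric E M)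
    (V : ∀ x : M, Submodule ℝ (TangentSpace 𝓘(ℝ, E) x →L[ℝ] TangentSpace 𝓘(ℝ, E) x)) (x : M)
    (I J K : TangentSpace 𝓘(ℝ, E) x →L[ℝ] TangentSpace 𝓘(ℝ, E) x) : Prop where
  triple : IsParaQuaternionTriple I J K
  skew_I (v w : TangentSpace 𝓘(ℝ, E) x) : g.inner x (I v) w = -g.inner x v (I w)
  skew_J (v w : TangentSpace 𝓘(ℝ, E) x) : g.inner x (J v) w = -g.inner x v (J w)
  skew_K (v w : TangentSpace 𝓘(ℝ, E) x) : g.inner x (K v) w = -g.inner x v (K w)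
  linearIndependent : LinearIndependent ℝ ![I, J, K]
  span_eq : Submodule.span ℝ {I, J, K} = V x

/-- The field `A` of endomorphisms of the tangent spaces is smooth on a neighbourhood of `x`. -/
def SmoothEndNear (A : ∀ y : M, TangentSpace 𝓘(ℝ, E) y →L[ℝ] TangentSpace 𝓘(ℝ, E) y) (x : M) : Prop :=
  ∀ᶠ z in 𝓝 x, ContMDiffAt 𝓘(ℝ, E) (𝓘(ℝ, E).prod 𝓘(ℝ, E →L[ℝ] E)) ∞
    (fun y ↦ TotalSpace.mk' (E →L[ℝ] E)
      (E := fun y ↦ TangentSpace 𝓘(ℝ, E) y →L[ℝ] TangentSpace 𝓘(ℝ, E) y) y (A y)) z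

/-- The vector field `X` is smooth on a neighbourhood of `x`. -/
def SmoothFieldNear (X : ∀ y : M, TangentSpace 𝓘(ℝ, E) y) (x : M) : Prop :=
  ∀ᶠ z in 𝓝 x,
    ContMDiffAt 𝓘(ℝ, E) 𝓘(ℝ, E).tangent ∞ (fun y ↦ (⟨y, X y⟩ : TangentBundle 𝓘(ℝ, E) M)) z

/-- `(M, g, V)` is an almost para-quaternion-Hermitian manifold: `V` is a rank `3` subbundle of
`End(TM)` that has, near each point, a smooth frame `(I, J, K)` of `g`-skew endomorphisms
satisfying the para-quaternion relations. -/
def IsAlmostParaQuaternionHermitian (g : PseudoRiemannianMetric E M)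
    (V : ∀ x : M, Submodule ℝ (TangentSpace 𝓘(ℝ, E) x →L[ℝ] TangentSpace 𝓘(ℝ, E) x)) : Prop :=
  ∀ x : M, ∃ I J K : ∀ y : M, TangentSpace 𝓘(ℝ, E) y →L[ℝ] TangentSpace 𝓘(ℝ, E) y,
    SmoothEndNear I x ∧ SmoothEndNear J x ∧ SmoothEndNear K x ∧
      ∀ᶠ y in 𝓝 x, IsAdaptedBasis g V y (I y) (J y) (K y)

/-- The wedge product of two alternating bilinear forms, as a sum over `(2, 2)`-shuffles. -/
def wedge {T : Type*} (α β : T → T → ℝ) (X Y Z W : T) : ℝ :=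
  α X Y * β Z W - α X Z * β Y W + α X W * β Y Z
    + α Y Z * β X W - α Y W * β X Z + α Z W * β X Y

/-- The two-form `Ω_A(X, Y) = g(X, A Y)`. -/
def twoForm (g : PseudoRiemannianMetric E M) (x : M)
    (A : TangentSpace 𝓘(ℝ, E) x →L[ℝ] TangentSpace 𝓘(ℝ, E) x) (X Y : TangentSpace 𝓘(ℝ, E) x) : ℝ :=
  g.inner x X (A Y)

/-- The four-form `Ω_I ∧ Ω_I - Ω_J ∧ Ω_J - Ω_K ∧ Ω_K` of a triple of endomorphisms. -/
def fourForm (g : PseudoRiemannianMetric E M) (x : M)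
    (I J K : TangentSpace 𝓘(ℝ, E) x →L[ℝ] TangentSpace 𝓘(ℝ, E) x)
    (X Y Z W : TangentSpace 𝓘(ℝ, E) x) : ℝ :=
  wedge (twoForm g x I) (twoForm g x I) X Y Z W
    - wedge (twoForm g x J) (twoForm g x J) X Y Z W
    - wedge (twoForm g x K) (twoForm g x K) X Y Z W

open Classical in
/-- The fundamental four-form `Ω` of `(M, g, V)`: at each point it is the four-form of an adapted
basis of `V x`. It does not depend on the choice of that basis, see `fundamentalForm_eq`. -/
def fundamentalForm (g : PseudoRiemannianMetric E M)
    (V : ∀ x : M, Submodule ℝ (TangentSpace 𝓘(ℝ, E) x →L[ℝ] TangentSpace 𝓘(ℝ, E) x)) (x : M) :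
    (X Y Z W : TangentSpace 𝓘(ℝ, E) x) → ℝ :=
  if h : ∃ B : Fin 3 → (TangentSpace 𝓘(ℝ, E) x →L[ℝ] TangentSpace 𝓘(ℝ, E) x),
      IsAdaptedBasis g V x (B 0) (B 1) (B 2) then
    fourForm g x (h.choose 0) (h.choose 1) (h.choose 2)
  else 0

theorem anticommutator {A : Type*} [Ring A] [Algebra ℝ A] {I J K : A} (hII : I * I = -1)
    (hJJ : J * J = 1) (hKK : K * K = 1) (hIJ : I * J = K) (hJI : J * I = -K) (hJK : J * K = -I)
    (hKJ : K * J = I) (hKI : K * I = J) (hIK : I * K = -J) (a b c a' b' c' : ℝ) :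
    (a • I + b • J + c • K) * (a' • I + b' • J + c' • K)
      + (a' • I + b' • J + c' • K) * (a • I + b • J + c • K)
      = (2 * (-(a * a') + b * b' + c * c')) • (1 : A) := by
  simp only [mul_add, add_mul, smul_mul_assoc, mul_smul_comm, hII, hJJ, hKK, hIJ, hJI, hJK, hKJ,
    hKI, hIK]
  module

/-- Two adapted bases of `V x` have the same four-form, so `Ω` is globally well defined. -/
theorem fourForm_eq {g : PseudoRiemannianMetric E M}
    {V : ∀ x : M, Submodule ℝ (TangentSpace 𝓘(ℝ, E) x →L[ℝ] TangentSpace 𝓘(ℝ, E) x)} {x : M}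
    {I J K I' J' K' : TangentSpace 𝓘(ℝ, E) x →L[ℝ] TangentSpace 𝓘(ℝ, E) x}
    (h : IsAdaptedBasis g V x I J K) (h' : IsAdaptedBasis g V x I' J' K') :
    fourForm g x I' J' K' = fourForm g x I J K := by
  let oneEnd : TangentSpace 𝓘(ℝ, E) x →L[ℝ] TangentSpace 𝓘(ℝ, E) x := 1
  have hone : (1 : TangentSpace 𝓘(ℝ, E) x →L[ℝ] TangentSpace 𝓘(ℝ, E) x) ≠ 0 := by
    intro h0
    refine h.linearIndependent.ne_zero 0 ?_
    change I = 0
    rw [← mul_one I, h0, mul_zero]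
  have hmem : ∀ A ∈ V x, ∃ a b c : ℝ, a • I + b • J + c • K = A := by
    intro A hA
    rw [← h.span_eq] at hA
    exact Submodule.mem_span_triple.1 hA
  have hsub : ({I', J', K'} : Set _) ⊆ V x := h'.span_eq ▸ Submodule.subset_span
  obtain ⟨a1, a2, a3, hI⟩ := hmem I' (hsub (by simp))
  obtain ⟨b1, b2, b3, hJ⟩ := hmem J' (hsub (by simp))
  obtain ⟨c1, c2, c3, hK⟩ := hmem K' (hsub (by simp))
  have t := h.triple
  have t' := h'.triple
  have key := anticommutator (I := I) (J := J) (K := K) t.I_I t.J_J t.K_K t.I_J t.J_I t.J_K t.K_J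
    t.K_I t.I_K
  have two : ∀ {s r : ℝ}, s • (1 : TangentSpace 𝓘(ℝ, E) x →L[ℝ] TangentSpace 𝓘(ℝ, E) x) = r • 1 →
      s = r := fun e ↦ smul_left_injective ℝ hone e
  have e1 := key a1 a2 a3 a1 a2 a3
  have e2 := key b1 b2 b3 b1 b2 b3
  have e3 := key c1 c2 c3 c1 c2 c3
  have e4 := key a1 a2 a3 b1 b2 b3
  have e5 := key a1 a2 a3 c1 c2 c3
  have e6 := key b1 b2 b3 c1 c2 c3
  rw [hI, show I' * I' = -1 from t'.I_I] at e1
  rw [hJ, show J' * J' = 1 from t'.J_J] at e2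
  rw [hK, show K' * K' = 1 from t'.K_K] at e3
  rw [hI, hJ, show I' * J' = K' from t'.I_J, show J' * I' = -K' from t'.J_I] at e4
  rw [hI, hK, show I' * K' = -J' from t'.I_K, show K' * I' = J' from t'.K_I] at e5
  rw [hJ, hK, show J' * K' = -I' from t'.J_K, show K' * J' = I' from t'.K_J] at e6
  replace e1 := two (Eq.trans (by module) e1 : (-2 : ℝ) • oneEnd = _ • oneEnd)
  replace e2 := two (Eq.trans (by module) e2 : (2 : ℝ) • oneEnd = _ • oneEnd)
  replace e3 := two (Eq.trans (by module) e3 : (2 : ℝ) • oneEnd = _ • oneEnd)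
  replace e4 := two (Eq.trans (by module) e4 : (0 : ℝ) • oneEnd = _ • oneEnd)
  replace e5 := two (Eq.trans (by module) e5 : (0 : ℝ) • oneEnd = _ • oneEnd)
  replace e6 := two (Eq.trans (by module) e6 : (0 : ℝ) • oneEnd = _ • oneEnd)
  have hR : (!![a1, a2, a3; b1, b2, b3; c1, c2, c3] : Matrix (Fin 3) (Fin 3) ℝ) *
      !![a1, -b1, -c1; -a2, b2, c2; -a3, b3, c3] = 1 := by
    ext i j
    fin_cases i <;> fin_cases j <;> simp [Matrix.mul_apply, Fin.sum_univ_three] <;> linarith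
  have hR' := mul_eq_one_comm.1 hR
  have f (i j : Fin 3) := congrFun (congrFun hR' i) j
  have f00 := f 0 0
  have f01 := f 0 1
  have f02 := f 0 2
  have f11 := f 1 1
  have f12 := f 1 2
  have f22 := f 2 2
  simp [Matrix.mul_apply, Fin.sum_univ_three] at f00 f01 f02 f11 f12 f22
  ext X Y Z W
  subst hI hJ hK
  simp only [fourForm, wedge, twoForm, add_apply, smul_apply, map_add, map_smul, smul_eq_mul]
  let q (A B : TangentSpace 𝓘(ℝ, E) x →L[ℝ] TangentSpace 𝓘(ℝ, E) x) : ℝ :=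
    g.inner x X (A Y) * g.inner x Z (B W) - g.inner x X (A Z) * g.inner x Y (B W)
      + g.inner x X (A W) * g.inner x Y (B Z) + g.inner x Y (A Z) * g.inner x X (B W)
      - g.inner x Y (A W) * g.inner x X (B Z) + g.inner x Z (A W) * g.inner x X (B Y)
  linear_combination q I I * f00 - q J J * f11 - q K K * f22 + 2 * q I J * f01
    + 2 * q I K * f02 - 2 * q J K * f12

theorem fundamentalForm_eq {g : PseudoRiemannianMetric E M}
    {V : ∀ x : M, Submodule ℝ (TangentSpace 𝓘(ℝ, E) x →L[ℝ] TangentSpace 𝓘(ℝ, E) x)} {x : M}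
    {I J K : TangentSpace 𝓘(ℝ, E) x →L[ℝ] TangentSpace 𝓘(ℝ, E) x}
    (h : IsAdaptedBasis g V x I J K) : fundamentalForm g V x = fourForm g x I J K := by
  have hex : ∃ B : Fin 3 → (TangentSpace 𝓘(ℝ, E) x →L[ℝ] TangentSpace 𝓘(ℝ, E) x),
      IsAdaptedBasis g V x (B 0) (B 1) (B 2) := ⟨![I, J, K], h⟩
  rw [fundamentalForm, dif_pos hex]
  exact fourForm_eq h hex.choose_spec

/-- The covariant derivative of a field `Ω` of four-linear forms,
`(∇_U Ω)(X, Y, Z, W) = U(Ω(X, Y, Z, W)) - Ω(∇_U X, Y, Z, W) - … - Ω(X, Y, Z, ∇_U W)`. -/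
def covDerivFourForm (cov : CovariantDerivative 𝓘(ℝ, E) E (TangentSpace 𝓘(ℝ, E) : M → Type _))
    (Ω : ∀ x : M, (X Y Z W : TangentSpace 𝓘(ℝ, E) x) → ℝ)
    (U X Y Z W : ∀ x : M, TangentSpace 𝓘(ℝ, E) x) (x : M) : ℝ :=
  mvfderiv 𝓘(ℝ, E) (fun y ↦ Ω y (X y) (Y y) (Z y) (W y)) x (U x)
    - Ω x (cov X x (U x)) (Y x) (Z x) (W x) - Ω x (X x) (cov Y x (U x)) (Z x) (W x)
    - Ω x (X x) (Y x) (cov Z x (U x)) (W x) - Ω x (X x) (Y x) (Z x) (cov W x (U x))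

/-- The covariant derivative of a field `A` of endomorphisms of the tangent spaces,
`(∇_U A) W = ∇_U (A W) - A (∇_U W)`. -/
def covDerivEnd (cov : CovariantDerivative 𝓘(ℝ, E) E (TangentSpace 𝓘(ℝ, E) : M → Type _))
    (A : ∀ x : M, TangentSpace 𝓘(ℝ, E) x →L[ℝ] TangentSpace 𝓘(ℝ, E) x)
    (U W : ∀ x : M, TangentSpace 𝓘(ℝ, E) x) (x : M) : TangentSpace 𝓘(ℝ, E) x :=
  cov (fun y ↦ A y (W y)) x (U x) - A x (cov W x (U x))

/-- `(M, g, V)` is nearly para-quaternion Kähler: `(∇_X Ω)(X, Y, Z, W) = 0` for all local smooth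
vector fields `X, Y, Z, W`, where `∇` is the Levi-Civita connection of `g`. -/
def IsNearlyParaQuaternionKahler (g : PseudoRiemannianMetric E M)
    (V : ∀ x : M, Submodule ℝ (TangentSpace 𝓘(ℝ, E) x →L[ℝ] TangentSpace 𝓘(ℝ, E) x)) : Prop :=
  ∀ (x : M) (X Y Z W : ∀ y : M, TangentSpace 𝓘(ℝ, E) y),
    SmoothFieldNear X x → SmoothFieldNear Y x → SmoothFieldNear Z x → SmoothFieldNear W x →
      covDerivFourForm g.leviCivita (fundamentalForm g V) X X Y Z W x = 0

/-- `V` is invariant under covariant differentiation with respect to the Levi-Civita connection: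
if `A` is a local smooth section of `V` and `U` a local smooth vector field, then the value of
`∇_U A` at each point `x` belongs to `V x`. -/
def IsParallel (g : PseudoRiemannianMetric E M)
    (V : ∀ x : M, Submodule ℝ (TangentSpace 𝓘(ℝ, E) x →L[ℝ] TangentSpace 𝓘(ℝ, E) x)) : Prop :=
  ∀ (x : M) (A : ∀ y : M, TangentSpace 𝓘(ℝ, E) y →L[ℝ] TangentSpace 𝓘(ℝ, E) y),
    SmoothEndNear A x → (∀ᶠ y in 𝓝 x, A y ∈ V y) →
      ∀ U : ∀ y : M, TangentSpace 𝓘(ℝ, E) y, SmoothFieldNear U x →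
        ∃ B ∈ V x, ∀ W : ∀ y : M, TangentSpace 𝓘(ℝ, E) y, SmoothFieldNear W x →
          covDerivEnd g.leviCivita A U W x = B (W x)

/-- `(M, g, V)` is a para-quaternion Kähler manifold. -/
structure IsParaQuaternionKahler (g : PseudoRiemannianMetric E M)
    (V : ∀ x : M, Submodule ℝ (TangentSpace 𝓘(ℝ, E) x →L[ℝ] TangentSpace 𝓘(ℝ, E) x)) : Prop where
  isAlmostParaQuaternionHermitian : IsAlmostParaQuaternionHermitian g V
  isParallel : IsParallel g V

end ParaQuaternion
end

/-! Fix a point, a local adapted frame `(I, J, K)` and write `P`, `Q`, `R` for the covariant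
derivatives of `I`, `J`, `K` in a direction `u`. Because `∇` is metric, differentiating the frame
relations gives linear identities between `P`, `Q`, `R`, and `∇_u Ω` is twice the form `Ω_P ∧ Ω_I -
Ω_Q ∧ Ω_J - Ω_R ∧ Ω_K`. This form is alternating in its arguments, and the hypothesis makes it
change sign when `u` is exchanged with an argument. The problem becomes pointwise algebra: `P`, `Q`,
`R` must lie in the span of `I`, `J`, `K`.

Let `T₊`, `T₋` be the eigenspaces of `J`. Both are isotropic, `I` exchanges them, and `ω(x, y) =
g(x, I y)` is nondegenerate on `T₊`. Since `Q` anticommutes with `J`, its restriction to `T₊` is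
encoded by the skew form `q(x, y) = g(x, Q y)` on `T₊`. For `x, e, y` in `T₊`, the form at `(x, e,
y, I e)` equals `2 (q(x, e) ω(y, e) - q(y, e) ω(x, e))` (`variationForm_pos_pos_pos_neg`). If this
vanishes for one fixed `x = f ≠ 0` and all `e, y`, then `q` is a multiple of `ω`
(`IsSkewTriple.exists_eq_mul`).

For `u = f` in `T₊` it vanishes by hypothesis. For `u = I f` in `T₋`, total skewness moves it to
direction `y` and arguments `(f, e, I f, I e)`, where the form vanishes for every variation
(`variationForm_pos_pos_neg_neg`). By linearity in `u`, always `Q = c I` on `T₊`. The symmetry `(I,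
-J, -K)` gives the same on `T₋`, so `Q` is a combination of `I` and `K`. The symmetry `(I, K, -J)`
treats `R`, and the relations then determine `P`. -/

namespace ParaQuaternion

/-! ### Pointwise algebra of skew para-quaternionic triples and their variations -/

section PointwiseAlgebra

variable {T : Type*} [AddCommGroup T] [Module ℝ T]

/-- A para-quaternionic triple of skew endomorphisms of a scalar product space. -/
structure IsSkewTriple (g : T →ₗ[ℝ] T →ₗ[ℝ] ℝ) (I J K : T →ₗ[ℝ] T) : Prop where
  symm (v w : T) : g v w = g w v
  nondegenerate (v : T) (hv : ∀ w, g v w = 0) : v = 0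
  I_I (v : T) : I (I v) = -v
  J_J (v : T) : J (J v) = v
  K_K (v : T) : K (K v) = v
  I_J (v : T) : I (J v) = K v
  J_I (v : T) : J (I v) = -K v
  J_K (v : T) : J (K v) = -I v
  K_J (v : T) : K (J v) = I v
  K_I (v : T) : K (I v) = J v
  I_K (v : T) : I (K v) = -J v
  skew_I (v w : T) : g (I v) w = -g v (I w)
  skew_J (v w : T) : g (J v) w = -g v (J w)
  skew_K (v w : T) : g (K v) w = -g v (K w)

/-- `(P, Q, R)` is an infinitesimal variation of the skew para-quaternionic triple `(I, J, K)`
through such triples. -/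
structure IsTripleVariation (g : T →ₗ[ℝ] T →ₗ[ℝ] ℝ) (I J K P Q R : T →ₗ[ℝ] T) : Prop where
  skew_P (v w : T) : g (P v) w = -g v (P w)
  skew_Q (v w : T) : g (Q v) w = -g v (Q w)
  skew_R (v w : T) : g (R v) w = -g v (R w)
  P_I (v : T) : P (I v) = -I (P v)
  Q_J (v : T) : Q (J v) = -J (Q v)
  R_K (v : T) : R (K v) = -K (R v)
  J_I (v : T) : Q (I v) + J (P v) = -R v
  J_K (v : T) : Q (K v) + J (R v) = -P v
  K_J (v : T) : R (J v) + K (Q v) = P v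
  K_I (v : T) : R (I v) + K (P v) = Q v

/-- Half the derivative of the four-form of `(I, J, K)` under the variation `(P, Q, R)`. -/
def variationForm (g : T →ₗ[ℝ] T →ₗ[ℝ] ℝ) (I J K P Q R : T →ₗ[ℝ] T) (X Y Z W : T) : ℝ :=
  wedge (fun X Y ↦ g X (P Y)) (fun X Y ↦ g X (I Y)) X Y Z W
    - wedge (fun X Y ↦ g X (Q Y)) (fun X Y ↦ g X (J Y)) X Y Z W
    - wedge (fun X Y ↦ g X (R Y)) (fun X Y ↦ g X (K Y)) X Y Z W

variable {g : T →ₗ[ℝ] T →ₗ[ℝ] ℝ} {I J K P Q R : T →ₗ[ℝ] T}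

/-- This symmetry exchanges the two eigenspaces of `J`, so results proved on the `1`-eigenspace
transfer to the `-1`-eigenspace. -/
theorem IsSkewTriple.neg (h : IsSkewTriple g I J K) : IsSkewTriple g I (-J) (-K) where
  symm := h.symm
  nondegenerate := h.nondegenerate
  I_I := h.I_I
  J_J v := by simp [h.J_J]
  K_K v := by simp [h.K_K]
  I_J v := by simp [h.I_J]
  J_I v := by simp [h.J_I]
  J_K v := by simp [h.J_K]
  K_J v := by simp [h.K_J]
  K_I v := by simp [h.K_I]
  I_K v := by simp [h.I_K]
  skew_I := h.skew_I
  skew_J v w := by simp [h.skew_J]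
  skew_K v w := by simp [h.skew_K]

/-- This symmetry puts `K` in the role of `J`, so results about the derivative of `J` transfer to
that of `K`. -/
theorem IsSkewTriple.rotate (h : IsSkewTriple g I J K) : IsSkewTriple g I K (-J) where
  symm := h.symm
  nondegenerate := h.nondegenerate
  I_I := h.I_I
  J_J := h.K_K
  K_K v := by simp [h.J_J]
  I_J v := by simp [h.I_K]
  J_I v := by simp [h.K_I]
  J_K v := by simp [h.K_J]
  K_J v := by simp [h.J_K]
  K_I v := by simp [h.J_I]
  I_K v := by simp [h.I_J]
  skew_I := h.skew_I
  skew_J := h.skew_K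
  skew_K v w := by simp [h.skew_J]

theorem IsTripleVariation.neg (h : IsTripleVariation g I J K P Q R) :
    IsTripleVariation g I (-J) (-K) P (-Q) (-R) where
  skew_P := h.skew_P
  skew_Q v w := by simp [h.skew_Q]
  skew_R v w := by simp [h.skew_R]
  P_I := h.P_I
  Q_J v := by simp [h.Q_J]
  R_K v := by simp [h.R_K]
  J_I v := by simpa [add_comm] using congrArg Neg.neg (h.J_I v)
  J_K v := by simpa using h.J_K v
  K_J v := by simpa using h.K_J v
  K_I v := by simpa [add_comm] using congrArg Neg.neg (h.K_I v)

theorem IsTripleVariation.rotate (h : IsTripleVariation g I J K P Q R) :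
    IsTripleVariation g I K (-J) P R (-Q) where
  skew_P := h.skew_P
  skew_Q := h.skew_R
  skew_R v w := by simp [h.skew_Q]
  P_I := h.P_I
  Q_J := h.R_K
  R_K v := by simp [h.Q_J]
  J_I v := by simpa using h.K_I v
  J_K v := by simpa [add_comm] using congrArg Neg.neg (h.K_J v)
  K_J v := by simpa [add_comm] using congrArg Neg.neg (h.J_K v)
  K_I v := by simpa [add_comm] using congrArg Neg.neg (h.J_I v)

theorem variationForm_neg (X Y Z W : T) :
    variationForm g I (-J) (-K) P (-Q) (-R) X Y Z W = variationForm g I J K P Q R X Y Z W := by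
  simp [variationForm, wedge]

theorem variationForm_rotate (X Y Z W : T) :
    variationForm g I K (-J) P R (-Q) X Y Z W = variationForm g I J K P Q R X Y Z W := by
  simp [variationForm, wedge]
  ring

theorem skew_swap {A : T →ₗ[ℝ] T} (hs : ∀ v w, g v w = g w v)
    (hA : ∀ v w, g (A v) w = -g v (A w)) (v w : T) : g v (A w) = -g w (A v) := by
  rw [hs, hA]

theorem variationForm_swap_one_two (h : IsSkewTriple g I J K)
    (h' : IsTripleVariation g I J K P Q R) (X Y Z W : T) :
    variationForm g I J K P Q R Y X Z W = -variationForm g I J K P Q R X Y Z W := by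
  simp only [variationForm, wedge, skew_swap h.symm h.skew_I Y X, skew_swap h.symm h.skew_J Y X,
    skew_swap h.symm h.skew_K Y X, skew_swap h.symm h'.skew_P Y X, skew_swap h.symm h'.skew_Q Y X,
    skew_swap h.symm h'.skew_R Y X]
  ring

theorem variationForm_swap_two_three (h : IsSkewTriple g I J K)
    (h' : IsTripleVariation g I J K P Q R) (X Y Z W : T) :
    variationForm g I J K P Q R X Z Y W = -variationForm g I J K P Q R X Y Z W := by
  simp only [variationForm, wedge, skew_swap h.symm h.skew_I Z Y, skew_swap h.symm h.skew_J Z Y,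
    skew_swap h.symm h.skew_K Z Y, skew_swap h.symm h'.skew_P Z Y, skew_swap h.symm h'.skew_Q Z Y,
    skew_swap h.symm h'.skew_R Z Y]
  ring

/-! ### The eigenspaces of `J` -/

theorem IsSkewTriple.apply_pos_pos (h : IsSkewTriple g I J K) {v w : T} (hv : J v = v)
    (hw : J w = w) : g v w = 0 := by
  have := h.skew_J v w
  rw [hv, hw] at this
  linarith

theorem IsSkewTriple.apply_neg_neg (h : IsSkewTriple g I J K) {v w : T} (hv : J v = -v)
    (hw : J w = -w) : g v w = 0 := by
  have := h.skew_J v w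
  rw [hv, hw] at this
  simp at this
  linarith

theorem IsSkewTriple.K_pos (h : IsSkewTriple g I J K) {v : T} (hv : J v = v) : K v = I v := by
  rw [← h.I_J, hv]

theorem IsSkewTriple.J_I_pos (h : IsSkewTriple g I J K) {v : T} (hv : J v = v) :
    J (I v) = -I v := by
  rw [h.J_I, h.K_pos hv]

/-- The derivative of `J² = Id` makes `Q` anticommute with `J`, so `Q` exchanges the eigenspaces of
`J`. -/
theorem IsTripleVariation.J_Q_pos (h' : IsTripleVariation g I J K P Q R) {v : T} (hv : J v = v) :
    J (Q v) = -Q v := by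
  have := h'.Q_J v
  rw [hv] at this
  exact (neg_eq_iff_eq_neg.1 this.symm)

theorem IsTripleVariation.J_Q_neg (h' : IsTripleVariation g I J K P Q R) {v : T} (hv : J v = -v) :
    J (Q v) = Q v := by
  have := h'.Q_J v
  rw [hv, map_neg] at this
  exact (neg_injective this).symm

/-- The derivative of `J I = -K` expresses `R` through `P` and `Q`. Pairing with a vector fixed by
the skew `J` turns `J P` into `-P`. This eliminates `R` from the evaluations below. -/
theorem IsTripleVariation.apply_R (h : IsSkewTriple g I J K)
    (h' : IsTripleVariation g I J K P Q R) {x : T} (hx : J x = x) (v : T) :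
    g x (R v) = g x (P v) - g x (Q (I v)) := by
  have h1 : R v = -(Q (I v) + J (P v)) := by rw [h'.J_I, neg_neg]
  have h2 := h.skew_J x (P v)
  rw [hx] at h2
  rw [h1, map_neg, map_add, h2]
  ring

theorem IsTripleVariation.apply_R_pos (h : IsSkewTriple g I J K)
    (h' : IsTripleVariation g I J K P Q R) {x v : T} (hx : J x = x) (hv : J v = v) :
    g x (R v) = g x (P v) := by
  rw [h'.apply_R h hx, h.apply_pos_pos hx (h'.J_Q_neg (h.J_I_pos hv)), sub_zero]

/-! ### The derivative of the four-form on eigenvectors of `J` -/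

theorem variationForm_pos_pos_neg_neg (h : IsSkewTriple g I J K)
    (h' : IsTripleVariation g I J K P Q R) {x e : T} (hx : J x = x) (he : J e = e) :
    variationForm g I J K P Q R x e (I x) (I e) = 0 := by
  have z {x y : T} (hx : J x = x) (hy : J y = y) := h.apply_pos_pos hx hy
  have n {x y : T} (hx : J x = x) (hy : J y = y) : g (I x) (I y) = 0 :=
    h.apply_neg_neg (h.J_I_pos hx) (h.J_I_pos hy)
  have q {x y : T} (hx : J x = x) (hy : J y = y) : g x (Q (I y)) = 0 :=
    z hx (h'.J_Q_neg (h.J_I_pos hy))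
  have k : g (I x) e = - g x (I e) := h.skew_I x e
  have p : g (I x) (P (I e)) = -g x (P e) := by
    rw [h'.P_I, map_neg, h.skew_I, h.I_I, map_neg, neg_neg]
  have r : g (I x) (R (I e)) = g x (P e) := by
    have h1 : R (I e) = -(Q (I (I e)) + J (P (I e))) := by rw [h'.J_I, neg_neg]
    have h2 := h.skew_J (I x) (P (I e))
    have h3 := h.apply_neg_neg (h.J_I_pos hx) (h'.J_Q_pos he)
    rw [h.J_I_pos hx] at h2
    simp only [map_neg, LinearMap.neg_apply, h.I_I] at h1 h2 ⊢
    rw [h1]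
    simp only [map_neg, map_add]
    linarith
  simp only [variationForm, wedge, hx, he, h.K_pos he, h.J_I_pos hx, h.J_I_pos he,
    h.K_I, h.I_I, map_neg, z hx he, z hx hx, z he he, z he hx, n hx he, h'.apply_R_pos h hx he,
    p, r, k, q hx hx, q hx he, q he hx, q he he]
  ring

/-- On the `1`-eigenspace `K = I`, and `R` differs from `P` only by a `Q` term. Hence the `P`
contributions of the `I` and `K` wedges cancel. What is left of them equals the contribution of the
`J` wedge, whence the factor 2. -/
theorem variationForm_pos_pos_pos_neg (h : IsSkewTriple g I J K)
    (h' : IsTripleVariation g I J K P Q R) {x e y : T} (hx : J x = x) (he : J e = e)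
    (hy : J y = y) :
    variationForm g I J K P Q R x e y (I e) =
      2 * (g x (Q e) * g y (I e) - g y (Q e) * g x (I e)) := by
  have z {x y : T} (hx : J x = x) (hy : J y = y) := h.apply_pos_pos hx hy
  have r {x y : T} (hx : J x = x) (hy : J y = y) := h'.apply_R_pos h hx hy
  have r' {x y : T} (hx : J x = x) : g x (R (I y)) = g x (P (I y)) + g x (Q y) := by
    rw [h'.apply_R h hx, h.I_I, map_neg, map_neg, sub_neg_eq_add]
  have hI := skew_swap h.symm h.skew_I e
  have hQ := skew_swap h.symm h'.skew_Q e
  have he0 : g e (I e) = 0 := by have := hI e; linarith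
  have he1 : g e (Q e) = 0 := by have := hQ e; linarith
  simp only [variationForm, wedge, he, hy, h.K_pos he, h.K_pos hy, h.J_I_pos he,
    h.K_I, h.I_I, map_neg, z hx he, z hx hy, z he hy, z hy he, z he he, r hx he, r hx hy, r he hy,
    r' hx, r' he, r' hy, hI y, hQ y, he0, he1]
  ring

/-! ### Skew forms proportional to the symplectic form of an eigenspace -/

theorem IsSkewTriple.exists_pairing_eq_one (h : IsSkewTriple g I J K) {f : T} (hf : J f = f)
    (h0 : f ≠ 0) : ∃ e, J e = e ∧ g f (I e) = 1 := by
  obtain ⟨w, hw⟩ : ∃ w, g f w ≠ 0 := by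
    by_contra! hc
    exact h0 (h.nondegenerate f hc)
  have hfJ := h.skew_J f w
  rw [hf] at hfJ
  -- Applying `I` to `(K w - I w) / 2` gives `(w - J w) / 2`, the `-1`-component of `w`. As the
  -- `1`-eigenspace is isotropic, `f` pairs with this component exactly as with `w`.
  refine ⟨(g f w)⁻¹ • ((1 / 2 : ℝ) • (K w - I w)), ?_, ?_⟩
  · simp only [map_smul, map_sub, h.J_K, h.J_I]
    module
  · simp only [map_smul, map_sub, h.I_K, h.I_I, map_neg, smul_eq_mul]
    have : (1 / 2 : ℝ) * (-g f (J w) - -g f w) = g f w := by linarith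
    rw [this, inv_mul_cancel₀ hw]

/-- A skew form `q` on the `1`-eigenspace of `J` is a multiple of the symplectic form
`g(⬝, I ⬝)` as soon as `q(f, e) g(y, I e) = q(y, e) g(f, I e)` for some fixed `f ≠ 0`. -/
theorem IsSkewTriple.exists_eq_mul (h : IsSkewTriple g I J K) {Q : T →ₗ[ℝ] T}
    (hQ : ∀ v w, g (Q v) w = -g v (Q w)) {f : T} (hf : J f = f) (h0 : f ≠ 0)
    (hq : ∀ e y, J e = e → J y = y → g f (Q e) * g y (I e) = g y (Q e) * g f (I e)) :
    ∃ c : ℝ, ∀ x y, J x = x → J y = y → g x (Q y) = c * g x (I y) := by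
  obtain ⟨e₀, he₀, h1⟩ := h.exists_pairing_eq_one hf h0
  set c := g f (Q e₀) with hc
  have hsI := skew_swap h.symm h.skew_I
  have hsQ := skew_swap h.symm hQ
  have k0 (y : T) (hy : J y = y) : g y (Q e₀) = c * g y (I e₀) := by
    have := hq e₀ y he₀ hy
    rw [h1] at this
    linarith
  -- Polarise `hq` from `e` to `e₀ + e`: the skew form `q - c ω` becomes the product of a linear
  -- form in `e` and the linear form `ω(⬝, e₀)` in `y`.
  have k1 (e y : T) (he : J e = e) (hy : J y = y) :
      g y (Q e) - c * g y (I e) = (g f (Q e) - c * g f (I e)) * g y (I e₀) := by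
    have a := hq (e₀ + e) y (by rw [map_add, he₀, he]) hy
    have b := hq e y he hy
    simp only [map_add, k0 y hy, ← hc, h1] at a
    linear_combination -a + b
  -- On the diagonal `y = e` the left side of `k1` vanishes by skewness.
  have k2 (e : T) (he : J e = e) : (g f (Q e) - c * g f (I e)) * g e (I e₀) = 0 := by
    have a := k1 e e he he
    have b := hsI e e
    have d := hsQ e e
    have b' : g e (I e) = 0 := by linarith
    have d' : g e (Q e) = 0 := by linarith
    rw [b', d'] at a
    linarith
  -- A product of two linear forms vanishes identically. The second is 1 at `f` while the first is 0
  -- there, so replacing `e` by `e + f` isolates the first.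
  have k3 (e : T) (he : J e = e) : g f (Q e) - c * g f (I e) = 0 := by
    have a := k2 (e + f) (by rw [map_add, he, hf])
    have b := k2 e he
    have p := hsI f f
    have q := hsQ f f
    have p' : g f (I f) = 0 := by linarith
    have q' : g f (Q f) = 0 := by linarith
    simp only [map_add, LinearMap.add_apply, p', q', h1] at a
    linear_combination a - b
  refine ⟨c, fun x y hx hy ↦ ?_⟩
  have := k1 y x hy hx
  rw [k3 y hy] at this
  linarith

/-- Splitting into eigenvectors of `J`: since `I` exchanges the eigenspaces, the `-1`-component is
`I` of a vector fixed by `J`. -/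
theorem IsSkewTriple.exists_add (h : IsSkewTriple g I J K) (v : T) :
    ∃ x y, J x = x ∧ J y = y ∧ v = x + I y := by
  refine ⟨(1 / 2 : ℝ) • (v + J v), (1 / 2 : ℝ) • (K v - I v), ?_, ?_, ?_⟩
  · simp only [map_smul, map_add, h.J_J]
    module
  · simp only [map_smul, map_sub, h.J_K, h.J_I]
    module
  · simp only [map_smul, map_sub, h.I_K, h.I_I]
    module

/-! ### Variations depending linearly on a direction, with totally skew derivative -/

section Families

variable {P Q R : T →ₗ[ℝ] T →ₗ[ℝ] T}

theorem variationForm_add (u v X Y Z W : T) :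
    variationForm g I J K (P (u + v)) (Q (u + v)) (R (u + v)) X Y Z W =
      variationForm g I J K (P u) (Q u) (R u) X Y Z W
        + variationForm g I J K (P v) (Q v) (R v) X Y Z W := by
  simp only [variationForm, wedge, map_add, LinearMap.add_apply]
  ring

/-- Polarisation of the hypothesis at `u + v`. -/
theorem variationForm_swap (hΩ : ∀ u Y Z W, variationForm g I J K (P u) (Q u) (R u) u Y Z W = 0)
    (u v Y Z W : T) : variationForm g I J K (P u) (Q u) (R u) v Y Z W =
      -variationForm g I J K (P v) (Q v) (R v) u Y Z W := by
  have h := hΩ (u + v) Y Z W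
  have h1 (w : T) : variationForm g I J K (P w) (Q w) (R w) (u + v) Y Z W =
      variationForm g I J K (P w) (Q w) (R w) u Y Z W
        + variationForm g I J K (P w) (Q w) (R w) v Y Z W := by
    simp only [variationForm, wedge, map_add, LinearMap.add_apply]
    ring
  rw [variationForm_add, h1, h1, hΩ, hΩ] at h
  linarith

/-- If the derivative of the four-form is totally skew then on the `1`-eigenspace of `J` each
`Q u` is a multiple of `I`. -/
theorem exists_eq_mul_of_variationForm_eq_zero (h : IsSkewTriple g I J K)
    (h' : ∀ u, IsTripleVariation g I J K (P u) (Q u) (R u))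
    (hΩ : ∀ u Y Z W, variationForm g I J K (P u) (Q u) (R u) u Y Z W = 0) (u : T) :
    ∃ c : ℝ, ∀ x y, J x = x → J y = y → g x (Q u y) = c * g x (I y) := by
  have pos (f : T) (hf : J f = f) :
      ∃ c : ℝ, ∀ x y, J x = x → J y = y → g x (Q f y) = c * g x (I y) := by
    by_cases h0 : f = 0
    · exact ⟨0, by simp [h0]⟩
    refine h.exists_eq_mul (h' f).skew_Q hf h0 fun e y he hy ↦ ?_
    have a := variationForm_pos_pos_pos_neg h (h' f) hf he hy
    rw [hΩ] at a
    linarith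
  have neg (f : T) (hf : J f = f) :
      ∃ c : ℝ, ∀ x y, J x = x → J y = y → g x (Q (I f) y) = c * g x (I y) := by
    by_cases h0 : f = 0
    · exact ⟨0, by simp [h0]⟩
    refine h.exists_eq_mul (h' _).skew_Q hf h0 fun e y he hy ↦ ?_
    have a := variationForm_pos_pos_pos_neg h (h' (I f)) hf he hy
    -- The direction `I f` does not occur among the arguments `(f, e, y, I e)`. The swaps below
    -- exchange it with `y`, leading up to sign to direction `y` at `(f, e, I f, I e)`, where the
    -- value is 0.
    have b := variationForm_pos_pos_neg_neg h (h' y) hf he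
    have c1 := variationForm_swap_one_two h (h' (I f)) f e y (I e)
    have c2 := variationForm_swap_two_three h (h' (I f)) e f y (I e)
    have c3 := variationForm_swap_one_two h (h' (I f)) e y f (I e)
    have c4 := variationForm_swap hΩ (I f) y e f (I e)
    have c5 := variationForm_swap_one_two h (h' y) (I f) e f (I e)
    have c6 := variationForm_swap_two_three h (h' y) e (I f) f (I e)
    have c7 := variationForm_swap_one_two h (h' y) e f (I f) (I e)
    linarith
  obtain ⟨v, w, hv, hw, rfl⟩ := h.exists_add u
  obtain ⟨c, hc⟩ := pos v hv
  obtain ⟨d, hd⟩ := neg w hw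
  refine ⟨c + d, fun x y hx hy ↦ ?_⟩
  rw [map_add, LinearMap.add_apply, map_add, hc x y hx hy, hd x y hx hy]
  ring

/-- Both `A y` and `c I y` lie in the isotropic `-1`-eigenspace, so by nondegeneracy they are
determined by their pairings with the `1`-eigenspace. -/
theorem IsSkewTriple.eq_smul (h : IsSkewTriple g I J K) {A : T →ₗ[ℝ] T}
    (hA : ∀ v, J v = v → J (A v) = -A v) {c : ℝ}
    (hc : ∀ x y, J x = x → J y = y → g x (A y) = c * g x (I y)) (y : T) (hy : J y = y) :
    A y = c • I y := by
  rw [← sub_eq_zero]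
  refine h.nondegenerate _ fun w ↦ ?_
  obtain ⟨x, z, hx, hz, rfl⟩ := h.exists_add w
  have h1 : g (A y) (I z) = 0 := h.apply_neg_neg (hA y hy) (h.J_I_pos hz)
  have h2 : g (I y) (I z) = 0 := h.apply_neg_neg (h.J_I_pos hy) (h.J_I_pos hz)
  rw [h.symm _ (x + I z)]
  simp only [map_add, map_sub, map_smul, LinearMap.add_apply, hc x y hx hy, smul_eq_mul,
    h.symm (I z), h1, h2]
  ring

/-- If the derivative of the four-form is totally skew then the derivative of `J` lies in the span
of `I` and `K`. -/
theorem exists_eq_smul_add_smul (h : IsSkewTriple g I J K)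
    (h' : ∀ u, IsTripleVariation g I J K (P u) (Q u) (R u))
    (hΩ : ∀ u Y Z W, variationForm g I J K (P u) (Q u) (R u) u Y Z W = 0) (u : T) :
    ∃ s t : ℝ, Q u = s • I + t • K := by
  obtain ⟨c, hc⟩ := exists_eq_mul_of_variationForm_eq_zero h h' hΩ u
  obtain ⟨d, hd⟩ := exists_eq_mul_of_variationForm_eq_zero (P := P) (Q := -Q) (R := -R) h.neg
    (fun u ↦ by rw [LinearMap.neg_apply, LinearMap.neg_apply]; exact (h' u).neg)
    (fun u Y Z W ↦ (variationForm_neg u Y Z W).trans (hΩ u Y Z W)) u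
  have hpos := h.eq_smul (fun v ↦ (h' u).J_Q_pos) hc
  have hneg := h.neg.eq_smul (fun v ↦ (h' u).neg.J_Q_pos) hd
  -- `K` is `I` on the `1`-eigenspace and `-I` on the other, while `Q` is `c I` and `-d I` there. So
  -- `s + t = c` and `s - t = -d`.
  refine ⟨(c - d) / 2, (c + d) / 2, LinearMap.ext fun v ↦ ?_⟩
  obtain ⟨x, z, hx, hz, rfl⟩ := h.exists_add v
  have h1 := hpos x hx
  have h2 := hneg (I z) (by simp [h.J_I_pos hz])
  rw [LinearMap.neg_apply, neg_eq_iff_eq_neg] at h2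
  simp only [map_add, LinearMap.add_apply, LinearMap.smul_apply, h1, h2, h.K_pos hx, h.K_I, h.I_I,
    hz]
  module

/-- If the derivative of the four-form is totally skew then the derivatives of `I`, `J` and `K`
are linear combinations of `I`, `J` and `K`. -/
theorem exists_eq_smul_of_variationForm_eq_zero (h : IsSkewTriple g I J K)
    (h' : ∀ u, IsTripleVariation g I J K (P u) (Q u) (R u))
    (hΩ : ∀ u Y Z W, variationForm g I J K (P u) (Q u) (R u) u Y Z W = 0) (u : T) :
    ∃ s t s' t' : ℝ, P u = s • J + s' • K ∧ Q u = s • I + t • K ∧ R u = s' • I - t' • J := by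
  obtain ⟨s, t, hQ⟩ := exists_eq_smul_add_smul h h' hΩ u
  obtain ⟨s', t', hR⟩ := exists_eq_smul_add_smul (P := P) (Q := R) (R := -Q) h.rotate
    (fun u ↦ by rw [LinearMap.neg_apply]; exact (h' u).rotate)
    (fun u Y Z W ↦ (variationForm_rotate u Y Z W).trans (hΩ u Y Z W)) u
  rw [smul_neg, ← sub_eq_add_neg] at hR
  -- Substitute `Q` and `R` into `P = -(Q K + J R)`; the squares of `K` and `J` leave a multiple of
  -- the identity.
  have hP (v : T) : P u v = (s • J v + s' • K v) + (t' - t) • v := by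
    have e := (h' u).J_K v
    rw [hQ, hR] at e
    simp only [LinearMap.add_apply, LinearMap.sub_apply, LinearMap.smul_apply, map_sub, map_smul,
      h.I_K, h.K_K, h.J_I, h.J_J] at e
    rw [← neg_eq_iff_eq_neg] at e
    rw [← e]
    module
  -- `P`, `J` and `K` are skew whereas the identity is symmetric, so its coefficient must act as
  -- zero.
  have h0 (v : T) : (t' - t) • v = 0 := by
    refine h.nondegenerate _ fun w ↦ ?_
    have e := (h' u).skew_P v w
    simp only [hP, map_add, map_smul, LinearMap.add_apply, LinearMap.smul_apply, h.skew_J,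
      h.skew_K, smul_eq_mul] at e ⊢
    linarith
  exact ⟨s, t, s', t', LinearMap.ext fun v ↦ by simp [hP, h0], hQ, hR⟩

end Families

end PointwiseAlgebra

/-! ### Directional derivatives of functions -/

section

variable {E : Type*} [NormedAddCommGroup E] [NormedSpace ℝ E]
  {M : Type*} [TopologicalSpace M] [ChartedSpace E M]

/-- `f` is differentiable at `x` with derivative `r` in the direction `u`. -/
def HasDerivAlong (f : M → ℝ) (x : M) (u : TangentSpace 𝓘(ℝ, E) x) (r : ℝ) : Prop :=
  MDiffAt f x ∧ mvfderiv 𝓘(ℝ, E) f x u = r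

namespace HasDerivAlong

variable {f f' : M → ℝ} {x : M} {u : TangentSpace 𝓘(ℝ, E) x} {r r' : ℝ}

theorem add (h : HasDerivAlong f x u r) (h' : HasDerivAlong f' x u r') :
    HasDerivAlong (fun y ↦ f y + f' y) x u (r + r') :=
  ⟨h.1.add h'.1, by rw [mvfderiv_fun_add h.1 h'.1, add_apply, h.2, h'.2]⟩

theorem sub (h : HasDerivAlong f x u r) (h' : HasDerivAlong f' x u r') :
    HasDerivAlong (fun y ↦ f y - f' y) x u (r - r') :=
  ⟨h.1.sub h'.1, by rw [mvfderiv_fun_sub h.1 h'.1, sub_apply, h.2, h'.2]⟩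

theorem mul (h : HasDerivAlong f x u r) (h' : HasDerivAlong f' x u r') :
    HasDerivAlong (fun y ↦ f y * f' y) x u (f x * r' + f' x * r) :=
  by
  refine ⟨h.1.mul h'.1, ?_⟩
  rw [mvfderiv_fun_mul h.1 h'.1, add_apply, smul_apply, smul_apply, h.2, h'.2]
  rfl

end HasDerivAlong

end

/-! ### Differentiating endomorphism fields and the four-form -/

section Geometry

variable {E : Type*} [NormedAddCommGroup E] [NormedSpace ℝ E]
  {M : Type*} [TopologicalSpace M] [ChartedSpace E M] [IsManifold 𝓘(ℝ, E) ∞ M]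

/-- The field `A` of endomorphisms of the tangent spaces is differentiable at `x`. -/
def EndMDifferentiableAt (A : ∀ y : M, TangentSpace 𝓘(ℝ, E) y →L[ℝ] TangentSpace 𝓘(ℝ, E) y)
    (x : M) : Prop :=
  MDifferentiableAt 𝓘(ℝ, E) (𝓘(ℝ, E).prod 𝓘(ℝ, E →L[ℝ] E))
    (fun y ↦ TotalSpace.mk' (E →L[ℝ] E)
      (E := fun y ↦ TangentSpace 𝓘(ℝ, E) y →L[ℝ] TangentSpace 𝓘(ℝ, E) y) y (A y)) x

theorem SmoothEndNear.mdifferentiableAt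
    {A : ∀ y : M, TangentSpace 𝓘(ℝ, E) y →L[ℝ] TangentSpace 𝓘(ℝ, E) y} {x : M}
    (hA : SmoothEndNear A x) : EndMDifferentiableAt A x :=
  hA.self_of_nhds.mdifferentiableAt (by simp)

theorem EndMDifferentiableAt.apply
    {A : ∀ y : M, TangentSpace 𝓘(ℝ, E) y →L[ℝ] TangentSpace 𝓘(ℝ, E) y} {x : M}
    (hA : EndMDifferentiableAt A x) {W : ∀ y : M, TangentSpace 𝓘(ℝ, E) y} (hW : MDiffAt (T% W) x) :
    MDiffAt (T% fun y ↦ A y (W y)) x :=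
  MDifferentiableAt.clm_bundle_apply (F₁ := E) (F₂ := E) hA hW

theorem SmoothFieldNear.mdifferentiableAt {X : ∀ y : M, TangentSpace 𝓘(ℝ, E) y} {x : M}
    (hX : SmoothFieldNear X x) : MDiffAt (T% X) x :=
  hX.self_of_nhds.mdifferentiableAt (by simp)

/-- Turns hypotheses about vector fields into identities for arbitrary tangent vectors at a point.
-/
theorem exists_smoothFieldNear {x : M} (v : TangentSpace 𝓘(ℝ, E) x) :
    ∃ X : ∀ y : M, TangentSpace 𝓘(ℝ, E) y, SmoothFieldNear X x ∧ X x = v := by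
  obtain ⟨s, hs, h⟩ := FiberBundle.exists_contMDiffOn_extend (k := ∞) 𝓘(ℝ, E) E v
  refine ⟨FiberBundle.extend E v, ?_, by simp⟩
  filter_upwards [eventually_mem_nhds_iff.2 hs] with z hz
  exact h.contMDiffAt hz

/-- The covariant derivative of a differentiable field of endomorphisms is tensorial. -/
theorem exists_covDerivEnd [FiniteDimensional ℝ E]
    (cov : CovariantDerivative 𝓘(ℝ, E) E (TangentSpace 𝓘(ℝ, E) : M → Type _))
    {A : ∀ y : M, TangentSpace 𝓘(ℝ, E) y →L[ℝ] TangentSpace 𝓘(ℝ, E) y} {x : M}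
    (hA : EndMDifferentiableAt A x) :
    ∃ D : TangentSpace 𝓘(ℝ, E) x →ₗ[ℝ] TangentSpace 𝓘(ℝ, E) x →ₗ[ℝ] TangentSpace 𝓘(ℝ, E) x,
      ∀ (u : TangentSpace 𝓘(ℝ, E) x) (W : ∀ y : M, TangentSpace 𝓘(ℝ, E) y), MDiffAt (T% W) x →
        cov (fun y ↦ A y (W y)) x u = D u (W x) + A x (cov W x u) := by
  have hc := cov.isCovariantDerivativeOn (s := Set.univ)
  have hΦ : TensorialAt 𝓘(ℝ, E) E (fun W : ∀ y : M, TangentSpace 𝓘(ℝ, E) y ↦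
      cov (fun y ↦ A y (W y)) x - A x ∘L cov W x) x := by
    constructor
    · intro f W hf hW
      have h1 : (fun y ↦ A y ((f • W) y)) = f • fun y ↦ A y (W y) := by
        ext y; simp
      rw [h1, hc.leibniz (hA.apply hW) hf trivial, hc.leibniz hW hf trivial]
      ext u
      simp
      module
    · intro W W' hW hW'
      have h1 : (fun y ↦ A y ((W + W') y)) = (fun y ↦ A y (W y)) + fun y ↦ A y (W' y) := by
        ext y; simp
      rw [h1, hc.add (hA.apply hW) (hA.apply hW') trivial, hc.add hW hW' trivial]
      ext u
      simp
      abel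
  let D := TensorialAt.mkHom _ x hΦ
  -- The homomorphism supplied by tensoriality takes the value of the field first and the direction
  -- second, hence the swap.
  refine ⟨LinearMap.mk₂ ℝ (fun u w ↦ D w u) (by simp) (by simp) (by simp) (by simp), ?_⟩
  intro u W hW
  have : D (W x) = _ := TensorialAt.mkHom_apply hΦ hW
  simp [this]

theorem mdifferentiableAt_inner (g : PseudoRiemannianMetric E M) {x : M}
    {σ τ : ∀ y : M, TangentSpace 𝓘(ℝ, E) y} (hσ : MDiffAt (T% σ) x) (hτ : MDiffAt (T% τ) x) :
    MDiffAt (fun y ↦ g.inner y (σ y) (τ y)) x := by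
  rw [mdifferentiableAt_fieldRep] at hσ hτ
  have h1 : MDifferentiableAt 𝓘(ℝ, E) 𝓘(ℝ, E →L[ℝ] ℝ) (fun y ↦ g.rep x y (fieldRep σ x y)) x :=
    (mdifferentiableAt_rep g x).clm_apply hσ
  have h2 : MDifferentiableAt 𝓘(ℝ, E) 𝓘(ℝ, ℝ)
    (fun y ↦ g.rep x y (fieldRep σ x y) (fieldRep τ x y)) x := h1.clm_apply hτ
  exact h2.congr_of_eventuallyEq (rep_fieldRep g x σ τ)

theorem hasDerivAlong_inner [FiniteDimensional ℝ E] (g : PseudoRiemannianMetric E M) {x : M}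
    {σ τ : ∀ y : M, TangentSpace 𝓘(ℝ, E) y} (hσ : MDiffAt (T% σ) x) (hτ : MDiffAt (T% τ) x)
    (u : TangentSpace 𝓘(ℝ, E) x) :
    HasDerivAlong (fun y ↦ g.inner y (σ y) (τ y)) x u
      (g.inner x (g.leviCivita σ x u) (τ x) + g.inner x (σ x) (g.leviCivita τ x u)) :=
  ⟨mdifferentiableAt_inner g hσ hτ, leviCivita_metric g hσ hτ u⟩

/-- Leibniz rule for the square `Ω_A ∧ Ω_A` of the two-form of a field `A` of endomorphisms. -/
theorem hasDerivAlong_wedge [FiniteDimensional ℝ E] (g : PseudoRiemannianMetric E M) {x : M}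
    {A : ∀ y : M, TangentSpace 𝓘(ℝ, E) y →L[ℝ] TangentSpace 𝓘(ℝ, E) y}
    (hA : EndMDifferentiableAt A x) {u : TangentSpace 𝓘(ℝ, E) x}
    {D : TangentSpace 𝓘(ℝ, E) x →ₗ[ℝ] TangentSpace 𝓘(ℝ, E) x}
    (hD : ∀ W : ∀ y : M, TangentSpace 𝓘(ℝ, E) y, MDiffAt (T% W) x →
      g.leviCivita (fun y ↦ A y (W y)) x u = D (W x) + A x (g.leviCivita W x u))
    {X Y Z W : ∀ y : M, TangentSpace 𝓘(ℝ, E) y} (hX : MDiffAt (T% X) x) (hY : MDiffAt (T% Y) x)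
    (hZ : MDiffAt (T% Z) x) (hW : MDiffAt (T% W) x) :
    HasDerivAlong
      (fun y ↦ wedge (twoForm g y (A y)) (twoForm g y (A y)) (X y) (Y y) (Z y) (W y)) x u
      (2 * wedge (fun v w ↦ g.inner x v (D w)) (twoForm g x (A x)) (X x) (Y x) (Z x) (W x)
        + wedge (twoForm g x (A x)) (twoForm g x (A x)) (g.leviCivita X x u) (Y x) (Z x) (W x)
        + wedge (twoForm g x (A x)) (twoForm g x (A x)) (X x) (g.leviCivita Y x u) (Z x) (W x)
        + wedge (twoForm g x (A x)) (twoForm g x (A x)) (X x) (Y x) (g.leviCivita Z x u) (W x)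
        + wedge (twoForm g x (A x)) (twoForm g x (A x)) (X x) (Y x) (Z x)
            (g.leviCivita W x u)) := by
  have key {σ τ : ∀ y : M, TangentSpace 𝓘(ℝ, E) y} (hσ : MDiffAt (T% σ) x)
      (hτ : MDiffAt (T% τ) x) :
      HasDerivAlong (fun y ↦ twoForm g y (A y) (σ y) (τ y)) x u
        (twoForm g x (A x) (g.leviCivita σ x u) (τ x) + (g.inner x (σ x) (D (τ x))
          + twoForm g x (A x) (σ x) (g.leviCivita τ x u))) := by
    have := hasDerivAlong_inner g hσ (hA.apply hτ) u
    rwa [hD τ hτ, map_add] at this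
  have := (((((key hX hY).mul (key hZ hW)).sub ((key hX hZ).mul (key hY hW))).add
    ((key hX hW).mul (key hY hZ))).add ((key hY hZ).mul (key hX hW))).sub
    ((key hY hW).mul (key hX hZ)) |>.add ((key hZ hW).mul (key hX hY))
  refine ⟨this.1, this.2.trans ?_⟩
  -- The two Leibniz terms `Ω_D ∧ Ω_A` and `Ω_A ∧ Ω_D` coincide, which gives the factor 2.
  simp only [wedge]
  ring

end Geometry

/-! ### From local adapted frames to the pointwise algebra -/

section Parallel

variable {E : Type*} [NormedAddCommGroup E] [NormedSpace ℝ E]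
  {M : Type*} [TopologicalSpace M] [ChartedSpace E M] [IsManifold 𝓘(ℝ, E) ∞ M]

/-- The metric at `x` as an algebraic bilinear form. -/
noncomputable def PseudoRiemannianMetric.bilin (g : PseudoRiemannianMetric E M) (x : M) :
    TangentSpace 𝓘(ℝ, E) x →ₗ[ℝ] TangentSpace 𝓘(ℝ, E) x →ₗ[ℝ] ℝ :=
  LinearMap.mk₂ ℝ (fun v w ↦ g.inner x v w) (by simp) (by simp) (by simp) (by simp)

theorem bilin_apply (g : PseudoRiemannianMetric E M) (x : M) (v w : TangentSpace 𝓘(ℝ, E) x) :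
    g.bilin x v w = g.inner x v w := rfl

theorem IsAdaptedBasis.isSkewTriple {g : PseudoRiemannianMetric E M}
    {V : ∀ x : M, Submodule ℝ (TangentSpace 𝓘(ℝ, E) x →L[ℝ] TangentSpace 𝓘(ℝ, E) x)} {x : M}
    {I J K : TangentSpace 𝓘(ℝ, E) x →L[ℝ] TangentSpace 𝓘(ℝ, E) x}
    (h : IsAdaptedBasis g V x I J K) :
    IsSkewTriple (g.bilin x) I.toLinearMap J.toLinearMap K.toLinearMap where
  symm := g.symm x
  nondegenerate := g.nondegenerate x
  I_I v := congrArg (fun A ↦ A v) h.triple.I_I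
  J_J v := congrArg (fun A ↦ A v) h.triple.J_J
  K_K v := congrArg (fun A ↦ A v) h.triple.K_K
  I_J v := congrArg (fun A ↦ A v) h.triple.I_J
  J_I v := congrArg (fun A ↦ A v) h.triple.J_I
  J_K v := congrArg (fun A ↦ A v) h.triple.J_K
  K_J v := congrArg (fun A ↦ A v) h.triple.K_J
  K_I v := congrArg (fun A ↦ A v) h.triple.K_I
  I_K v := congrArg (fun A ↦ A v) h.triple.I_K
  skew_I := h.skew_I
  skew_J := h.skew_J
  skew_K := h.skew_K

/-- `D` is the covariant derivative at `x` in the direction `u` of the field `A` of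
endomorphisms. -/
def IsCovDerivEndAt (cov : CovariantDerivative 𝓘(ℝ, E) E (TangentSpace 𝓘(ℝ, E) : M → Type _))
    (A : ∀ y : M, TangentSpace 𝓘(ℝ, E) y →L[ℝ] TangentSpace 𝓘(ℝ, E) y) (x : M)
    (u : TangentSpace 𝓘(ℝ, E) x) (D : TangentSpace 𝓘(ℝ, E) x →ₗ[ℝ] TangentSpace 𝓘(ℝ, E) x) :
    Prop :=
  ∀ W : ∀ y : M, TangentSpace 𝓘(ℝ, E) y, MDiffAt (T% W) x →
    cov (fun y ↦ A y (W y)) x u = D (W x) + A x (cov W x u)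

section Leibniz

variable {cov : CovariantDerivative 𝓘(ℝ, E) E (TangentSpace 𝓘(ℝ, E) : M → Type _)}
  {A B C : ∀ y : M, TangentSpace 𝓘(ℝ, E) y →L[ℝ] TangentSpace 𝓘(ℝ, E) y} {x : M}
  {u : TangentSpace 𝓘(ℝ, E) x} {D D' D'' : TangentSpace 𝓘(ℝ, E) x →ₗ[ℝ] TangentSpace 𝓘(ℝ, E) x}

theorem cov_smul {f : M → ℝ} {σ : ∀ y : M, TangentSpace 𝓘(ℝ, E) y} (hf : MDiffAt f x)
    (hσ : MDiffAt (T% σ) x) (u : TangentSpace 𝓘(ℝ, E) x) : cov (fun y ↦ f y • σ y) x u =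
      f x • cov σ x u + mvfderiv 𝓘(ℝ, E) f x u • σ x := by
  have := (cov.isCovariantDerivativeOn (s := Set.univ)).leibniz hσ hf trivial
  exact congrArg (fun L ↦ L u) this

theorem cov_add {σ τ : ∀ y : M, TangentSpace 𝓘(ℝ, E) y} (hσ : MDiffAt (T% σ) x)
    (hτ : MDiffAt (T% τ) x) (u : TangentSpace 𝓘(ℝ, E) x) :
    cov (fun y ↦ σ y + τ y) x u = cov σ x u + cov τ x u := by
  have := (cov.isCovariantDerivativeOn (s := Set.univ)).add hσ hτ trivial
  exact congrArg (fun L ↦ L u) this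

theorem cov_congr {σ τ : ∀ y : M, TangentSpace 𝓘(ℝ, E) y} (hσ : MDiffAt (T% σ) x)
    (hτ : MDiffAt (T% τ) x) (h : ∀ᶠ y in 𝓝 x, σ y = τ y) : cov σ x = cov τ x :=
  (cov.isCovariantDerivativeOn (s := Set.univ)).congr_of_eventuallyEq hσ hτ Filter.univ_mem h

theorem cov_neg {σ : ∀ y : M, TangentSpace 𝓘(ℝ, E) y} (hσ : MDiffAt (T% σ) x)
    (u : TangentSpace 𝓘(ℝ, E) x) : cov (fun y ↦ -σ y) x u = -cov σ x u := by
  have h := cov_smul (cov := cov) (f := fun _ ↦ (-1 : ℝ)) mdifferentiableAt_const hσ u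
  simpa [mvfderiv_const] using h

theorem IsCovDerivEndAt.neg (hA : EndMDifferentiableAt A x) (h : IsCovDerivEndAt cov A x u D) :
    IsCovDerivEndAt cov (fun y ↦ -A y) x u (-D) := by
  intro W hW
  refine (cov_neg (hA.apply hW) u).trans ?_
  rw [h W hW, neg_add]
  rfl

theorem isCovDerivEndAt_id :
    IsCovDerivEndAt cov (fun y ↦ ContinuousLinearMap.id ℝ (TangentSpace 𝓘(ℝ, E) y)) x u 0 := by
  intro W _
  simp

theorem isCovDerivEndAt_neg_id :
    IsCovDerivEndAt cov (fun y ↦ -ContinuousLinearMap.id ℝ (TangentSpace 𝓘(ℝ, E) y)) x u 0 := by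
  intro W hW
  refine (cov_neg hW u).trans ?_
  simp

/-- The product rule for the composition of two fields of endomorphisms. -/
theorem IsCovDerivEndAt.comp_eq (hA : EndMDifferentiableAt A x) (hB : EndMDifferentiableAt B x)
    (h : IsCovDerivEndAt cov A x u D) (h' : IsCovDerivEndAt cov B x u D')
    (h'' : IsCovDerivEndAt cov C x u D'') (hC : ∀ᶠ y in 𝓝 x, A y ∘L B y = C y)
    (w : TangentSpace 𝓘(ℝ, E) x) : D (B x w) + A x (D' w) = D'' w := by
  obtain ⟨W, hW, rfl⟩ := exists_smoothFieldNear w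
  replace hW := hW.mdifferentiableAt
  have hAB := hA.apply (hB.apply hW)
  have he : ∀ᶠ y in 𝓝 x, A y (B y (W y)) = C y (W y) := by
    filter_upwards [hC] with y hy
    rw [← hy]
    rfl
  have hCW : MDiffAt (T% fun y ↦ C y (W y)) x :=
    hAB.congr_of_eventuallyEq (by filter_upwards [he] with y hy; rw [hy])
  have h1 := congrArg (fun L ↦ L u) (cov_congr (cov := cov) hAB hCW he)
  have h2 : A x (B x (cov W x u)) = C x (cov W x u) := by
    rw [← hC.self_of_nhds]
    rfl
  -- Both sides expand `∇_u (C W)`; the terms `A B ∇_u W` and `C ∇_u W` agree at `x` and cancel.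
  rw [h _ (hB.apply hW), h' _ hW, h'' _ hW, map_add, h2, ← add_assoc] at h1
  exact add_right_cancel h1

end Leibniz

/-- The coefficients of a section of `V` in an adapted frame are differentiable, up to a common
nonvanishing factor. -/
theorem exists_frame_coefficients {g : PseudoRiemannianMetric E M}
    {V : ∀ x : M, Submodule ℝ (TangentSpace 𝓘(ℝ, E) x →L[ℝ] TangentSpace 𝓘(ℝ, E) x)} {x : M}
    {I J K A : ∀ y : M, TangentSpace 𝓘(ℝ, E) y →L[ℝ] TangentSpace 𝓘(ℝ, E) y}
    (hI : EndMDifferentiableAt I x) (hJ : EndMDifferentiableAt J x)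
    (hK : EndMDifferentiableAt K x) (hA : EndMDifferentiableAt A x)
    (hV : ∀ᶠ y in 𝓝 x, IsAdaptedBasis g V y (I y) (J y) (K y)) (hAV : ∀ᶠ y in 𝓝 x, A y ∈ V y) :
    ∃ f a b c : M → ℝ, MDiffAt f x ∧ MDiffAt a x ∧ MDiffAt b x ∧ MDiffAt c x ∧ f x = 1 ∧
      ∀ᶠ y in 𝓝 x, ∀ w, f y • A y w = a y • I y w + (b y • J y w + c y • K y w) := by
  have h0 : ∃ v w, g.inner x v w ≠ 0 := by
    by_contra! hc
    refine hV.self_of_nhds.linearIndependent.ne_zero 0 ?_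
    change I x = 0
    ext v
    exact g.nondegenerate x _ (hc _)
  obtain ⟨v, w, hvw⟩ := h0
  obtain ⟨X, hX, hXv⟩ := exists_smoothFieldNear v
  -- Normalised so that the common factor `f = 2 g(X, Y)` is 1 at `x`.
  obtain ⟨Y, hY, hYw⟩ := exists_smoothFieldNear ((2 * g.inner x v w)⁻¹ • w)
  replace hX := hX.mdifferentiableAt
  replace hY := hY.mdifferentiableAt
  have hf := mdifferentiableAt_inner g hX hY
  -- For `A = a I + b J + c K`, the anticommutators of `A` with `I`, `J`, `K` are `-2a`, `2b`, `2c`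
  -- times the identity. Pairing them with `X` and `Y` therefore extracts `f a`, `f b`, `f c` as
  -- differentiable functions, up to the sign for `I`.
  have hB {B : ∀ y : M, TangentSpace 𝓘(ℝ, E) y →L[ℝ] TangentSpace 𝓘(ℝ, E) y}
      (hB : EndMDifferentiableAt B x) :
      MDiffAt (fun y ↦ g.inner y (A y (B y (X y))) (Y y) + g.inner y (B y (A y (X y))) (Y y)) x :=
    (mdifferentiableAt_inner g (hA.apply (hB.apply hX)) hY).add
      (mdifferentiableAt_inner g (hB.apply (hA.apply hX)) hY)
  refine ⟨_, _, _, _, hf.add hf, (hB hI).neg, hB hJ, hB hK, ?_, ?_⟩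
  · simp only [Pi.add_apply, hXv, hYw, map_smul, smul_eq_mul]
    field_simp
    norm_num
  · filter_upwards [hV, hAV] with y hy hAy w
    rw [← hy.span_eq] at hAy
    obtain ⟨a, b, c, habc⟩ := Submodule.mem_span_triple.1 hAy
    have t := hy.isSkewTriple
    have s (v : TangentSpace 𝓘(ℝ, E) y) : A y v = a • I y v + b • J y v + c • K y v := by
      rw [← habc]; rfl
    have t1 : ∀ v, I y (I y v) = -v := t.I_I
    have t2 : ∀ v, J y (J y v) = v := t.J_J
    have t3 : ∀ v, K y (K y v) = v := t.K_K
    have t4 : ∀ v, I y (J y v) = K y v := t.I_J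
    have t5 : ∀ v, J y (I y v) = -K y v := t.J_I
    have t6 : ∀ v, J y (K y v) = -I y v := t.J_K
    have t7 : ∀ v, K y (J y v) = I y v := t.K_J
    have t8 : ∀ v, K y (I y v) = J y v := t.K_I
    have t9 : ∀ v, I y (K y v) = -J y v := t.I_K
    simp only [Pi.add_apply, Pi.neg_apply, s, map_add, map_smul, t1, t2, t3, t4, t5, t6, t7, t8, t9,
      map_neg, add_apply, smul_apply, neg_apply, smul_eq_mul]
    module

variable [FiniteDimensional ℝ E]

/-- Differentiate `g(A X, Y) + g(X, A Y) = 0` with the metric connection; skewness of `A` at `x`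
cancels the terms in `∇X` and `∇Y`. -/
theorem IsCovDerivEndAt.skew {g : PseudoRiemannianMetric E M}
    {A : ∀ y : M, TangentSpace 𝓘(ℝ, E) y →L[ℝ] TangentSpace 𝓘(ℝ, E) y} {x : M}
    {u : TangentSpace 𝓘(ℝ, E) x} {D : TangentSpace 𝓘(ℝ, E) x →ₗ[ℝ] TangentSpace 𝓘(ℝ, E) x}
    (hA : EndMDifferentiableAt A x) (h : IsCovDerivEndAt g.leviCivita A x u D)
    (hs : ∀ᶠ y in 𝓝 x, ∀ v w, g.inner y (A y v) w = -g.inner y v (A y w))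
    (v w : TangentSpace 𝓘(ℝ, E) x) : g.inner x (D v) w = -g.inner x v (D w) := by
  obtain ⟨X, hX, rfl⟩ := exists_smoothFieldNear v
  obtain ⟨Y, hY, rfl⟩ := exists_smoothFieldNear w
  replace hX := hX.mdifferentiableAt
  replace hY := hY.mdifferentiableAt
  have h1 := (hasDerivAlong_inner g (hA.apply hX) hY u).add
    (hasDerivAlong_inner g hX (hA.apply hY) u)
  have h2 : (fun y ↦ g.inner y (A y (X y)) (Y y) + g.inner y (X y) (A y (Y y))) =ᶠ[𝓝 x]
      fun _ ↦ 0 := by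
    filter_upwards [hs] with y hy
    rw [hy, neg_add_cancel]
  have h3 := h1.2
  rw [mvfderiv_congr h2, mvfderiv_const, h X hX, h Y hY] at h3
  have e1 := hs.self_of_nhds (X x) (g.leviCivita Y x u)
  have e2 := hs.self_of_nhds (g.leviCivita X x u) (Y x)
  simp only [map_add, add_apply] at h3
  rw [e1, e2] at h3
  have h4 : (0 : ℝ) = _ := h3
  linarith

/-- The covariant derivatives of a local adapted frame form a variation of it. -/
theorem isTripleVariation_of_frame {g : PseudoRiemannianMetric E M}
    {V : ∀ x : M, Submodule ℝ (TangentSpace 𝓘(ℝ, E) x →L[ℝ] TangentSpace 𝓘(ℝ, E) x)} {x : M}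
    {I J K : ∀ y : M, TangentSpace 𝓘(ℝ, E) y →L[ℝ] TangentSpace 𝓘(ℝ, E) y}
    (hI : EndMDifferentiableAt I x) (hJ : EndMDifferentiableAt J x)
    (hK : EndMDifferentiableAt K x)
    (hV : ∀ᶠ y in 𝓝 x, IsAdaptedBasis g V y (I y) (J y) (K y)) {u : TangentSpace 𝓘(ℝ, E) x}
    {P Q R : TangentSpace 𝓘(ℝ, E) x →ₗ[ℝ] TangentSpace 𝓘(ℝ, E) x}
    (hP : IsCovDerivEndAt g.leviCivita I x u P) (hQ : IsCovDerivEndAt g.leviCivita J x u Q)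
    (hR : IsCovDerivEndAt g.leviCivita K x u R) :
    IsTripleVariation (g.bilin x) (I x).toLinearMap (J x).toLinearMap (K x).toLinearMap P Q R := by
  have hid := isCovDerivEndAt_id (cov := g.leviCivita) (u := u)
  have hJJ := hQ.comp_eq hJ hJ hQ hid (hV.mono fun y hy ↦ hy.triple.J_J)
  have hKK := hR.comp_eq hK hK hR hid (hV.mono fun y hy ↦ hy.triple.K_K)
  have hII := hP.comp_eq hI hI hP isCovDerivEndAt_neg_id (hV.mono fun y hy ↦ hy.triple.I_I)
  exact {
    skew_P := hP.skew hI (hV.mono fun y hy ↦ hy.skew_I)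
    skew_Q := hQ.skew hJ (hV.mono fun y hy ↦ hy.skew_J)
    skew_R := hR.skew hK (hV.mono fun y hy ↦ hy.skew_K)
    P_I := fun v ↦ eq_neg_of_add_eq_zero_left (hII v)
    Q_J := fun v ↦ eq_neg_of_add_eq_zero_left (hJJ v)
    R_K := fun v ↦ eq_neg_of_add_eq_zero_left (hKK v)
    J_I := hQ.comp_eq hJ hI hP (hR.neg hK) (hV.mono fun y hy ↦ hy.triple.J_I)
    J_K := hQ.comp_eq hJ hK hR (hP.neg hI) (hV.mono fun y hy ↦ hy.triple.J_K)
    K_J := hR.comp_eq hK hJ hQ hP (hV.mono fun y hy ↦ hy.triple.K_J)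
    K_I := hR.comp_eq hK hI hP hQ (hV.mono fun y hy ↦ hy.triple.K_I) }

/-- Near `x` the fundamental form is that of the frame, so the Leibniz rule applies to each wedge
square. The terms where an argument is differentiated are those subtracted in `∇Ω`. -/
theorem covDerivFourForm_eq_variationForm {g : PseudoRiemannianMetric E M}
    {V : ∀ x : M, Submodule ℝ (TangentSpace 𝓘(ℝ, E) x →L[ℝ] TangentSpace 𝓘(ℝ, E) x)} {x : M}
    {I J K : ∀ y : M, TangentSpace 𝓘(ℝ, E) y →L[ℝ] TangentSpace 𝓘(ℝ, E) y}
    (hI : EndMDifferentiableAt I x) (hJ : EndMDifferentiableAt J x)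
    (hK : EndMDifferentiableAt K x)
    (hV : ∀ᶠ y in 𝓝 x, IsAdaptedBasis g V y (I y) (J y) (K y))
    {U X Y Z W : ∀ y : M, TangentSpace 𝓘(ℝ, E) y}
    {P Q R : TangentSpace 𝓘(ℝ, E) x →ₗ[ℝ] TangentSpace 𝓘(ℝ, E) x}
    (hP : IsCovDerivEndAt g.leviCivita I x (U x) P)
    (hQ : IsCovDerivEndAt g.leviCivita J x (U x) Q)
    (hR : IsCovDerivEndAt g.leviCivita K x (U x) R)
    (hX : MDiffAt (T% X) x) (hY : MDiffAt (T% Y) x) (hZ : MDiffAt (T% Z) x)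
    (hW : MDiffAt (T% W) x) :
    covDerivFourForm g.leviCivita (fundamentalForm g V) U X Y Z W x =
      2 * variationForm (g.bilin x) (I x).toLinearMap (J x).toLinearMap (K x).toLinearMap P Q R
        (X x) (Y x) (Z x) (W x) := by
  have h1 := ((hasDerivAlong_wedge g hI hP hX hY hZ hW).sub
    (hasDerivAlong_wedge g hJ hQ hX hY hZ hW)).sub (hasDerivAlong_wedge g hK hR hX hY hZ hW)
  have h2 : (fun y ↦ fundamentalForm g V y (X y) (Y y) (Z y) (W y)) =ᶠ[𝓝 x]
      fun y ↦ fourForm g y (I y) (J y) (K y) (X y) (Y y) (Z y) (W y) := by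
    filter_upwards [hV] with y hy
    rw [fundamentalForm_eq hy]
  have h3 := h1.2
  rw [covDerivFourForm, mvfderiv_congr h2, fundamentalForm_eq hV.self_of_nhds]
  simp only [fourForm]
  rw [h3]
  have e (A : TangentSpace 𝓘(ℝ, E) x →L[ℝ] TangentSpace 𝓘(ℝ, E) x) :
      twoForm g x A = fun v w ↦ g.bilin x v (A.toLinearMap w) := rfl
  simp only [variationForm, e, bilin_apply]
  ring

theorem isParallel_of_nearly {g : PseudoRiemannianMetric E M}
    {V : ∀ x : M, Submodule ℝ (TangentSpace 𝓘(ℝ, E) x →L[ℝ] TangentSpace 𝓘(ℝ, E) x)}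
    (hV : IsAlmostParaQuaternionHermitian g V) (hΩ : IsNearlyParaQuaternionKahler g V) :
    IsParallel g V := by
  intro x A hA hAV U hU
  replace hA := hA.mdifferentiableAt
  obtain ⟨I, J, K, hI, hJ, hK, hB⟩ := hV x
  replace hI := hI.mdifferentiableAt
  replace hJ := hJ.mdifferentiableAt
  replace hK := hK.mdifferentiableAt
  obtain ⟨P, hP⟩ := exists_covDerivEnd g.leviCivita hI
  obtain ⟨Q, hQ⟩ := exists_covDerivEnd g.leviCivita hJ
  obtain ⟨R, hR⟩ := exists_covDerivEnd g.leviCivita hK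
  have hform (u Y Z W : TangentSpace 𝓘(ℝ, E) x) :
      variationForm (g.bilin x) (I x).toLinearMap (J x).toLinearMap (K x).toLinearMap (P u) (Q u)
        (R u) u Y Z W = 0 := by
    obtain ⟨u, hu, rfl⟩ := exists_smoothFieldNear u
    obtain ⟨Y, hY, rfl⟩ := exists_smoothFieldNear Y
    obtain ⟨Z, hZ, rfl⟩ := exists_smoothFieldNear Z
    obtain ⟨W, hW, rfl⟩ := exists_smoothFieldNear W
    have := covDerivFourForm_eq_variationForm hI hJ hK hB (hP (u x)) (hQ (u x)) (hR (u x))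
      hu.mdifferentiableAt hY.mdifferentiableAt hZ.mdifferentiableAt hW.mdifferentiableAt
    rw [hΩ x u Y Z W hu hY hZ hW] at this
    linarith
  obtain ⟨s, t, s', t', hPu, hQu, hRu⟩ := exists_eq_smul_of_variationForm_eq_zero
    hB.self_of_nhds.isSkewTriple
    (fun u ↦ isTripleVariation_of_frame hI hJ hK hB (hP u) (hQ u) (hR u)) hform (U x)
  obtain ⟨f, a, b, c, hf, ha, hb, hc, hfx, heq⟩ := exists_frame_coefficients hI hJ hK hA hB hAV
  let d (f : M → ℝ) : ℝ := mvfderiv 𝓘(ℝ, E) f x (U x)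
  have hsub : ({I x, J x, K x} : Set _) ⊆ V x :=
    hB.self_of_nhds.span_eq ▸ Submodule.subset_span
  have hIV : I x ∈ V x := hsub (by simp)
  have hJV : J x ∈ V x := hsub (by simp)
  have hKV : K x ∈ V x := hsub (by simp)
  have hAx : A x ∈ V x := hAV.self_of_nhds
  -- Differentiating `f A = a I + b J + c K` at `x`, where `f = 1`, and solving for `∇A` gives this
  -- endomorphism.
  refine ⟨a x • (s • J x + s' • K x) + b x • (s • I x + t • K x) + c x • (s' • I x - t' • J x)
    + (d a • I x + d b • J x + d c • K x) - d f • A x, ?_, ?_⟩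
  · refine (V x).sub_mem ((V x).add_mem ((V x).add_mem ((V x).add_mem ?_ ?_) ?_)
      ((V x).add_mem ((V x).add_mem ?_ ?_) ?_)) ((V x).smul_mem _ hAx)
    · exact (V x).smul_mem _ ((V x).add_mem ((V x).smul_mem _ hJV) ((V x).smul_mem _ hKV))
    · exact (V x).smul_mem _ ((V x).add_mem ((V x).smul_mem _ hIV) ((V x).smul_mem _ hKV))
    · exact (V x).smul_mem _ ((V x).sub_mem ((V x).smul_mem _ hIV) ((V x).smul_mem _ hJV))
    · exact (V x).smul_mem _ hIV
    · exact (V x).smul_mem _ hJV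
    · exact (V x).smul_mem _ hKV
  · intro W hW
    replace hW := hW.mdifferentiableAt
    have mA := hf.smul_section (hA.apply hW)
    have mI := ha.smul_section (hI.apply hW)
    have mJ := hb.smul_section (hJ.apply hW)
    have mK := hc.smul_section (hK.apply hW)
    have mJK := mdifferentiableAt_add_section mJ mK
    have e := congrArg (fun L ↦ L (U x)) (cov_congr (cov := g.leviCivita) mA
      (mdifferentiableAt_add_section mI mJK) (heq.mono fun y hy ↦ hy (W y)))
    have e' : g.leviCivita (fun y ↦ f y • A y (W y)) x (U x) =
        g.leviCivita (fun y ↦ a y • I y (W y)) x (U x) +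
          (g.leviCivita (fun y ↦ b y • J y (W y)) x (U x) +
            g.leviCivita (fun y ↦ c y • K y (W y)) x (U x)) :=
      e.trans ((cov_add mI mJK (U x)).trans (congrArg _ (cov_add mJ mK (U x))))
    rw [cov_smul hf (hA.apply hW), cov_smul ha (hI.apply hW), cov_smul hb (hJ.apply hW),
      cov_smul hc (hK.apply hW), hP _ _ hW, hQ _ _ hW, hR _ _ hW, hPu, hQu, hRu, hfx,
      one_smul] at e'
    have hx := heq.self_of_nhds (g.leviCivita W x (U x))
    rw [hfx, one_smul] at hx
    rw [covDerivEnd, hx, eq_sub_of_add_eq e']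
    simp only [LinearMap.add_apply, LinearMap.sub_apply, LinearMap.smul_apply,
      ContinuousLinearMap.coe_coe, add_apply, sub_apply, smul_apply, d]
    module

end Parallel
end ParaQuaternion

theorem theorem1 {E : Type*} [NormedAddCommGroup E] [NormedSpace ℝ E] [FiniteDimensional ℝ E]
    {M : Type*} [TopologicalSpace M] [ChartedSpace E M] [IsManifold 𝓘(ℝ, E) ∞ M]
    (g : ParaQuaternion.PseudoRiemannianMetric E M)
    (V : ∀ x : M, Submodule ℝ (TangentSpace 𝓘(ℝ, E) x →L[ℝ] TangentSpace 𝓘(ℝ, E) x))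
    (hV : ParaQuaternion.IsAlmostParaQuaternionHermitian g V)
    (hΩ : ParaQuaternion.IsNearlyParaQuaternionKahler g V) :
    ParaQuaternion.IsParaQuaternionKahler g V :=
  ⟨hV, ParaQuaternion.isParallel_of_nearly hV hΩ⟩
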